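/- **Definitions.** A polynomial $p\in\mathbb{Q}[x]$ is *integral* if $p(\mathbb{Z})\subseteq\mathbb{Z}$; polynomials $p_1,\dots,p_r$ are *essentially distinct* if $p_i$ and $p_i-p_j$ are non-constant for all $i\neq j$. For $k\geq 1$ let $p^{[k]}=\binom{p}{k}=\frac{p(p-1)\cdots(p-k+1)}{k!}$, and for $P=\{p_1,\dots,p_r\}$ let $\Lambda_k(P)$ be the matrix of polynomials with $k$ blocks of $r$ rows and with $k$ columns, whose entry in row $j$ of block $i$ and in column $l$ ($1\le j\le r$, $1\le i,l\le k$) is $p_j^{[i-l+1]}$ if $l\leq i$ and $0$ if $l>i$. Let $\mathbb{R}\text{-span}(\Lambda_k(P))\subseteq\mathbb{R}^{kr}$ be the linear span of all columns of the matrices $\Lambda_k(P)(x)$, $x\in\mathbb{R}$. The space of *$k$-Weyl polynomials* of $P$ is $$\mathrm{WP}_k(P)=\{\mathbf v^{T}\Lambda_k(P)\,\mathbf e_1 \;:\; \mathbf v\in\mathbb{R}^r\times \mathbb{R}\text{-span}(\Lambda_{k-1}(P))^{\perp}\}\subseteq\mathbb{R}[x],$$ where $\perp$ is taken in $\mathbb{R}^{(k-1)r}$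 for the Euclidean inner product, and where for $k=1$ this means $\mathrm{WP}_1(P)=\langle p_1,\dots,p_r\rangle_{\mathbb{R}}$. A *Weyl system* $(X,\mu,T)$ consists of a compact abelian Lie group $X$ (that is, up to isomorphism, the product of a finite-dimensional torus and a finite abelian group), its Haar probability measure $\mu$, and an ergodic transformation $T(x)=a+U(x)$, where $a\in X$ and $U$ is a topological group automorphism of $X$ whose restriction to the identity component of $X$ is unipotent. It is a *$d$-step* Weyl system if $(X,T)$ is topologically conjugate to a translation $x\Gamma\mapsto gx\Gamma$ on $G/\Gamma$, where $G$ is a Lie group that is nilpotent of step at most $d$, $\Gamma$ is a discrete cocompact subgroup of $G$, and $g\in G$. Write $Tf=f\circ T$, and $\mathbb{T}=\mathbb{R}/\mathbb{Z}$. **Theorem.** Let $d,r\geq 1$ be integers and let $(X,\mu,T)$ be a $d$-step Weyl system. Let $p_1,\dots,p_r$ be essentially distinct integral polynomials, and let $h$ be an integral polynomial such that $$h-h(0)\notin \mathrm{WP}_d\big(\{p_1-p_1(0),\dots,p_r-p_r(0)\}\big)$$ (if $h$ and all $p_j$ have zero constant term, this says $h\notin\mathrm{WP}_d(\{p_1,\dots,p_r\})$).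 Let $\alpha\in\mathbb{R}\setminus\mathbb{Q}$, let $g:\mathbb{T}\to\mathbb{C}$ be Riemann integrable with $\int_{\mathbb{T}} g\,dm_{\mathbb{T}}=0$ (where $m_{\mathbb{T}}$ is the Haar probability measure), and let $f_0,f_1,\dots,f_r\in L^\infty(\mu)$. Then $$\lim_{N\to\infty}\frac1N\sum_{n=1}^N g(h(n)\alpha)\int_X f_0\cdot T^{p_1(n)}f_1\cdots T^{p_r(n)}f_r\,d\mu=0 .$$ -/

import Mathlib

open MeasureTheory Filter Topology Polynomial
open scoped Manifold ContDiff

/-! ### Integral polynomials -/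

/-- `p ∈ ℚ[x]` is integral if `p(ℤ) ⊆ ℤ`. -/
def IsIntegralPoly (p : ℚ[X]) : Prop :=
  ∀ n : ℤ, ∃ m : ℤ, p.eval (n : ℚ) = (m : ℚ)

/-- The value `p(n)` as an integer. (For an integral polynomial `p(n)` is an integer, so that the
floor does nothing; see `intValue_spec`.) -/
def intValue (p : ℚ[X]) (n : ℤ) : ℤ := ⌊p.eval (n : ℚ)⌋

theorem intValue_spec {p : ℚ[X]} (hp : IsIntegralPoly p) (n : ℤ) :
    ((intValue p n : ℤ) : ℚ) = p.eval (n : ℚ) := by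
  obtain ⟨m, hm⟩ := hp n
  simp [intValue, hm]

/-- `p` is a constant polynomial. -/
def IsConstPoly (p : ℚ[X]) : Prop := ∃ c : ℚ, p = C c

/-- `p₁, …, p_r` are essentially distinct: for all `i ≠ j`, both `p_i` and `p_i - p_j` are
non-constant. -/
def EssentiallyDistinct {r : ℕ} (p : Fin r → ℚ[X]) : Prop :=
  ∀ i j, i ≠ j → ¬ IsConstPoly (p i) ∧ ¬ IsConstPoly (p i - p j)

/-- The polynomial `p - p(0)`. -/
noncomputable def dropConst (p : ℚ[X]) : ℚ[X] := p - C (p.eval 0)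

/-! ### Weyl polynomials -/

/-- The polynomial `p^[k] = binom(p, k) = p (p - 1) ⋯ (p - k + 1) / k!`, with real coefficients. -/
noncomputable def binomPoly (p : ℚ[X]) (k : ℕ) : ℝ[X] :=
  C ((k.factorial : ℝ)⁻¹) * (descPochhammer ℝ k).comp (p.map (algebraMap ℚ ℝ))

/-- The matrix `Λ_k(P)`: `k` blocks of `r` rows each and `k` columns. With blocks and columns
counted from `0`, the entry in row `j` of block `i` and in column `l` is `p_j^[i - l + 1]` if
`l ≤ i`, and `0` otherwise. -/
noncomputable def weylMatrix {r : ℕ} (p : Fin r → ℚ[X]) (k : ℕ) :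
    Matrix (Fin k × Fin r) (Fin k) ℝ[X] :=
  fun ij l => if l ≤ ij.1 then binomPoly (p ij.2) ((ij.1 : ℕ) - (l : ℕ) + 1) else 0

/-- The real span of the columns `M_l(x)`, `x ∈ ℝ`, of a matrix with polynomial entries. -/
noncomputable def polySpan {ι κ : Type*} (M : Matrix ι κ ℝ[X]) : Submodule ℝ (ι → ℝ) :=
  Submodule.span ℝ {w | ∃ (l : κ) (x : ℝ), w = fun i => (M i l).eval x}

/-- The set `WP_k(P)` of `k`-Weyl polynomials generated by `P = {p₁, …, p_r}`, `k ≥ 1`: all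
polynomials `ξ(v) = vᵀ Λ_k(P) e₁` with `v ∈ ℝ^r × span(Λ_{k-1}(P))^⊥` (orthogonal complement for
the Euclidean inner product). For `k = 1` there is no second factor, and `WP₁(P)` is the linear
span of `P`. The value at `k = 0` is a convention that is never used. -/
def weylPolys {r : ℕ} (p : Fin r → ℚ[X]) : ℕ → Set ℝ[X]
  | 0 => {0}
  | k + 1 => {q | ∃ v : Fin (k + 1) × Fin r → ℝ,
      (∀ w ∈ polySpan (weylMatrix p k), ∑ ij : Fin k × Fin r, v (ij.1.succ, ij.2) * w ij = 0) ∧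
      q = ∑ ij : Fin (k + 1) × Fin r, C (v ij) * weylMatrix p (k + 1) ij 0}

/-! ### Weyl systems -/

/-- `X` is a compact abelian Lie group, that is, isomorphic as a topological group to the product
of a finite-dimensional torus and a finite abelian group. -/
def IsTorusTimesFinite (X : Type*) [AddCommGroup X] [TopologicalSpace X] : Prop :=
  ∃ (k : ℕ) (F : Type) (_ : AddCommGroup F) (_ : TopologicalSpace F) (_ : DiscreteTopology F)
    (_ : Finite F), Nonempty (X ≃ₜ+ ((Fin k → UnitAddCircle) × F))

/-- `T` is a unipotent affine transformation: `T x = a + U x` with `U` an automorphism of the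
topological group `X` whose restriction to the identity component is unipotent, i.e. `U - 1` is
nilpotent there. -/
def IsUnipotentAffine {X : Type*} [AddCommGroup X] [TopologicalSpace X] (T : X ≃ₜ X) : Prop :=
  ∃ (a : X) (U : X ≃ₜ+ X), (∀ x, T x = a + U x) ∧
    ∃ m : ℕ, ∀ x ∈ connectedComponent (0 : X), (fun y => U y - y)^[m] x = 0

/-- `(X, μ, T)` is a Weyl system: `X` is a compact abelian Lie group with its Haar probability
measure `μ`, and `T` is an ergodic unipotent affine transformation of `X`. -/
structure IsWeylSystem {X : Type*} [AddCommGroup X] [TopologicalSpace X] [IsTopologicalAddGroup X]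
    [MeasurableSpace X] [BorelSpace X] (μ : Measure X) (T : X ≃ₜ X) : Prop where
  torusTimesFinite : IsTorusTimesFinite X
  isAddHaar : μ.IsAddHaarMeasure
  isProbability : IsProbabilityMeasure μ
  unipotentAffine : IsUnipotentAffine T
  ergodic : Ergodic T μ

/-- `(X, T)` can be realized as a `d`-step nilsystem: it is conjugate to a translation
`x Γ ↦ g x Γ` on `G ⧸ Γ`, with `G` a (real, finite-dimensional, not necessarily connected) Lie
group that is `d`-step nilpotent and `Γ` a discrete cocompact subgroup. The `0`-th term of the lower
central series is `G` itself and each next term is the commutator of the previous one with `G`, so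
that the `d`-th term is trivial exactly when `G` is nilpotent of step at most `d`. -/
def IsNilsystemOfStep (d : ℕ) {X : Type*} [TopologicalSpace X] (T : X ≃ₜ X) : Prop :=
  ∃ (G : Type) (_ : Group G) (_ : TopologicalSpace G) (_ : T2Space G)
    (_ : SecondCountableTopology G) (m : ℕ) (_ : ChartedSpace (EuclideanSpace ℝ (Fin m)) G)
    (_ : LieGroup (𝓡 m) ∞ G) (Γ : Subgroup G) (g : G) (Φ : X ≃ₜ G ⧸ Γ),
    (⊤ : Subgroup G).lowerCentralSeries d = ⊥ ∧ DiscreteTopology Γ ∧ CompactSpace (G ⧸ Γ) ∧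
    ∀ x, Φ (T x) = g • Φ x

/-- `(X, μ, T)` is a `d`-step Weyl system. -/
def IsStepWeylSystem (d : ℕ) {X : Type*} [AddCommGroup X] [TopologicalSpace X]
    [IsTopologicalAddGroup X] [MeasurableSpace X] [BorelSpace X] (μ : Measure X) (T : X ≃ₜ X) :
    Prop :=
  IsWeylSystem μ T ∧ IsNilsystemOfStep d T

/-! ### Riemann integrability on the circle -/

/-- The unit interval as a box. -/
def unitBox : BoxIntegral.Box (Fin 1) := ⟨fun _ => 0, fun _ => 1, fun _ => one_pos⟩

/-- `g : 𝕋 = ℝ/ℤ → ℂ` is Riemann integrable: `t ↦ g(t mod 1)` is Riemann integrable on `[0, 1]`. -/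
def RiemannIntegrableCircle (g : UnitAddCircle → ℂ) : Prop :=
  BoxIntegral.Integrable unitBox BoxIntegral.IntegrationParams.Riemann
    (fun t : Fin 1 → ℝ => g ((t 0 : ℝ) : UnitAddCircle)) BoxIntegral.BoxAdditiveMap.volume

/-! Call `φ : X → ℝ/ℤ` a phase polynomial of degree at most `d` if `d + 1` applications of `Δφ = φ ∘
T - φ` kill it. On a `d`-step Weyl system these functions separate points
(`exists_mem_polyPhases_separating`). They form a group, so by Stone–Weierstrass the functions
`exp(2πiφ)` span a dense space. Hence each `f_j` may be replaced by such an exponential. Likewise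
`g`, having mean zero, may be replaced by a nontrivial character `θ ↦ exp(2πimθ)`; Riemann
integrability gives a continuous sandwich that justifies this.

What remains is the phase `m h(n)α + ∑ φ_j(T^{p_j(n)} x)`. By Newton's formula `φ_j(T^n x) = ∑
binom(n,i) Δ^i φ_j(x)`, so for fixed `x` it is a real polynomial in `n`. Weyl's theorem makes the
averages vanish unless all its non-constant coefficients are rational. Suppose the bad points have
positive measure. A `ℚ`-linear map `L : ℝ → ℚ` that kills `ℚ` but not `α` turns rationality into a
linear relation between `h` and the binomials `binom(p_j,i)`, with coefficients `L(Δ^i φ_j(x))`. By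
Poincaré recurrence some `x` returns to the bad set infinitely often. The relations at the points
`T^n x` have coefficients polynomial in `n`, so they split into one relation for each `binom(n,l)`.
The one for `l = 0` expresses `h` through the binomials; those for `l ≥ 1` are exactly the
orthogonality to `Λ_{d-1}`. Thus `h` is a Weyl polynomial, a contradiction
(`ae_cesaroNull_of_notMem_weylPolys`). Dominated convergence finishes the argument.

Separation of points needs `(U - 1)^d = 0` on the torus (`sub_one_pow_torusIncl_eq_zero`), although
the conjugacy with the nilsystem is only topological. Winding numbers provide this. Lifting a loop
in `X` to a path in `G`, differencing a function corresponds to taking a commutator of the path with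
a fixed element, so after `d` steps all winding numbers vanish. This is done for a power `T^q` that
fixes the components; unipotence of `U` then descends from `U^q` to `U`. -/

/-! ### Cesàro averages and van der Corput's inequality -/

/-- The averages `(1/N) ∑_{n < N} u n` tend to `0`. -/
def CesaroNull (u : ℕ → ℂ) : Prop :=
  Tendsto (fun N : ℕ => (1 / (N : ℂ)) * ∑ n ∈ Finset.range N, u n) atTop (𝓝 0)

theorem CesaroNull.add {u v : ℕ → ℂ} (hu : CesaroNull u) (hv : CesaroNull v) :
    CesaroNull (fun n => u n + v n) := by
  have := Tendsto.add hu hv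
  simpa [CesaroNull, Finset.sum_add_distrib, mul_add] using this

theorem CesaroNull.const_mul {u : ℕ → ℂ} (c : ℂ) (hu : CesaroNull u) :
    CesaroNull (fun n => c * u n) := by
  have := Tendsto.const_mul c hu
  rw [mul_zero] at this
  refine this.congr fun N => ?_
  rw [← Finset.mul_sum]; ring

theorem cesaroNull_zero : CesaroNull (fun _ => 0) := by
  simp [CesaroNull]

theorem CesaroNull.sum {ι : Type*} (s : Finset ι) {u : ι → ℕ → ℂ}
    (hu : ∀ i ∈ s, CesaroNull (u i)) : CesaroNull (fun n => ∑ i ∈ s, u i n) := by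
  classical
  induction s using Finset.induction_on with
  | empty => simpa using cesaroNull_zero
  | insert a s ha ih =>
    simp only [Finset.sum_insert ha]
    exact (hu a (by simp)).add (ih fun i hi => hu i (by simp [hi]))

theorem cesaroNull_of_norm_sum_le {u : ℕ → ℂ} (C : ℝ)
    (h : ∀ N, ‖∑ n ∈ Finset.range N, u n‖ ≤ C) : CesaroNull u := by
  have h1 : Tendsto (fun N : ℕ => C / (N : ℝ)) atTop (𝓝 0) :=
    tendsto_const_div_atTop_nhds_zero_nat C
  refine squeeze_zero_norm (fun N => ?_) h1
  rw [norm_mul, norm_div, norm_one, Complex.norm_natCast, one_div, div_eq_inv_mul]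
  exact mul_le_mul_of_nonneg_left (h N) (by positivity)

theorem CesaroNull.of_norm_sum_sub_le {u v : ℕ → ℂ} (hu : CesaroNull u) (C : ℝ)
    (h : ∀ N, ‖∑ n ∈ Finset.range N, (v n - u n)‖ ≤ C) : CesaroNull v := by
  simpa using hu.add (cesaroNull_of_norm_sum_le C h)

/-- The sum telescopes to two blocks of length `k`, one at each end. -/
theorem norm_sum_range_shift_sub_le {u : ℕ → ℂ} {C : ℝ} (hu : ∀ n, ‖u n‖ ≤ C) (k N : ℕ) :
    ‖∑ n ∈ Finset.range N, (u (n + k) - u n)‖ ≤ 2 * k * C := by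
  have h1 : ∑ n ∈ Finset.range N, (u (n + k) - u n)
      = ∑ n ∈ Finset.range k, u (N + n) - ∑ n ∈ Finset.range k, u n := by
    have e1 := Finset.sum_range_add u N k
    have e2 := Finset.sum_range_add u k N
    rw [add_comm k N, e1] at e2
    rw [Finset.sum_sub_distrib]
    simp only [add_comm _ k]
    linear_combination -e2
  rw [h1]
  have bd : ∀ f : ℕ → ℂ, (∀ n, ‖f n‖ ≤ C) → ‖∑ n ∈ Finset.range k, f n‖ ≤ k * C := by
    intro f hf
    refine (norm_sum_le_of_le _ fun n _ => hf n).trans ?_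
    simp
  calc _ ≤ ‖∑ n ∈ Finset.range k, u (N + n)‖ + ‖∑ n ∈ Finset.range k, u n‖ := norm_sub_le _ _
    _ ≤ k * C + k * C := add_le_add (bd _ fun n => hu _) (bd _ hu)
    _ = _ := by ring

theorem CesaroNull.shift {u : ℕ → ℂ} {C : ℝ} (hu : CesaroNull u) (hC : ∀ n, ‖u n‖ ≤ C) (k : ℕ) :
    CesaroNull (fun n => u (n + k)) :=
  hu.of_norm_sum_sub_le _ fun N => norm_sum_range_shift_sub_le hC k N

theorem CesaroNull.conj {u : ℕ → ℂ} (hu : CesaroNull u) :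
    CesaroNull (fun n => starRingEnd ℂ (u n)) := by
  have := (Complex.continuous_conj.tendsto 0).comp hu
  simpa [CesaroNull, Function.comp_def] using this

/-- Uniform approximation on average preserves vanishing of the averages. -/
theorem cesaroNull_of_approx {u : ℕ → ℂ}
    (h : ∀ ε > 0, ∃ v : ℕ → ℂ, CesaroNull v ∧
      ∀ᶠ N : ℕ in atTop, ∑ n ∈ Finset.range N, ‖u n - v n‖ ≤ ε * N) : CesaroNull u := by
  rw [CesaroNull, Metric.tendsto_atTop']
  intro ε hε
  obtain ⟨v, hv, huv⟩ := h (ε / 2) (by positivity)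
  have h1 := (Metric.tendsto_atTop'.mp hv) (ε / 2) (by positivity)
  obtain ⟨N₁, hN₁⟩ := h1
  obtain ⟨N₂, hN₂⟩ := eventually_atTop.mp huv
  refine ⟨max N₁ N₂, fun N hN => ?_⟩
  have a1 := hN₁ N (lt_of_le_of_lt (le_max_left _ _) hN)
  have a2 := hN₂ N (le_of_lt (lt_of_le_of_lt (le_max_right _ _) hN))
  have hN0 : (0 : ℝ) < N := by
    exact_mod_cast lt_of_le_of_lt (Nat.zero_le _) hN
  rw [dist_zero_right] at a1 ⊢
  have e : (1 / (N : ℂ)) * ∑ n ∈ Finset.range N, u n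
      = (1 / (N : ℂ)) * ∑ n ∈ Finset.range N, v n
        + (1 / (N : ℂ)) * ∑ n ∈ Finset.range N, (u n - v n) := by
    rw [Finset.sum_sub_distrib]; ring
  rw [e]
  refine lt_of_le_of_lt (norm_add_le _ _) ?_
  have a3 : ‖(1 / (N : ℂ)) * ∑ n ∈ Finset.range N, (u n - v n)‖ ≤ ε / 2 := by
    rw [norm_mul, norm_div, norm_one, Complex.norm_natCast, one_div, inv_mul_le_iff₀ hN0]
    exact ((norm_sum_le _ _).trans a2).trans (by rw [mul_comm])
  linarith

theorem norm_sum_sq_le_card_mul {ι : Type*} (s : Finset ι) (f : ι → ℂ) :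
    ‖∑ i ∈ s, f i‖ ^ 2 ≤ s.card * ∑ i ∈ s, ‖f i‖ ^ 2 :=
  (pow_le_pow_left₀ (norm_nonneg _) (norm_sum_le _ _) 2).trans sq_sum_le_card_mul_sum_sq

/-- **Van der Corput's lemma**. -/
theorem cesaroNull_of_vanDerCorput {u : ℕ → ℂ} (hu : ∀ n, ‖u n‖ ≤ 1)
    (h : ∀ k, 0 < k → CesaroNull (fun n => u (n + k) * starRingEnd ℂ (u n))) : CesaroNull u := by
  have hb : ∀ k l n, ‖u (n + k) * starRingEnd ℂ (u (n + l))‖ ≤ 1 := by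
    intro k l n
    rw [norm_mul, RCLike.norm_conj]
    exact mul_le_one₀ (hu _) (norm_nonneg _) (hu _)
  have hlt : ∀ k l, l < k → CesaroNull (fun n => u (n + k) * starRingEnd ℂ (u (n + l))) := by
    intro k l hkl
    have h1 := (h (k - l) (by omega)).shift (fun n => by simpa using hb (k - l) 0 n) l
    refine h1.congr fun N => ?_
    congr 1
    refine Finset.sum_congr rfl fun n _ => ?_
    dsimp only
    rw [show n + l + (k - l) = n + k by omega]
  have hne : ∀ k l, l ≠ k → CesaroNull (fun n => u (n + k) * starRingEnd ℂ (u (n + l))) := by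
    intro k l hkl
    rcases lt_or_gt_of_ne hkl with h1 | h1
    · exact hlt k l h1
    · have := (hlt l k h1).conj
      simpa [mul_comm] using this
  -- Averaging over `H` shifts costs at most `2H²`. By Cauchy–Schwarz and expansion of the square,
  -- the diagonal contributes at most `N H` and the off-diagonal pairs eventually at most `N`.
  have key : ∀ H : ℕ, 0 < H → ∀ᶠ N : ℕ in atTop,
      ‖∑ n ∈ Finset.range N, u n‖ ≤ (√(H + 1) / H + 2 * H / N) * N := by
    intro H hH
    have hlim := CesaroNull.sum (Finset.range H ×ˢ Finset.range H)
      (u := fun kl n => if kl.1 = kl.2 then 0 else u (n + kl.1) * starRingEnd ℂ (u (n + kl.2)))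
      (fun kl _ => by
        by_cases hkl : kl.1 = kl.2
        · simpa [hkl] using cesaroNull_zero
        · simpa [hkl] using hne kl.1 kl.2 (Ne.symm hkl))
    have hlim' := (Metric.tendsto_atTop.mp hlim) 1 one_pos
    obtain ⟨N₀, hN₀⟩ := hlim'
    filter_upwards [eventually_ge_atTop N₀, eventually_gt_atTop 0] with N hN hN0
    have hNr : (0 : ℝ) < N := by exact_mod_cast hN0
    have hHr : (0 : ℝ) < H := by exact_mod_cast hH
    have b1 := hN₀ N hN
    rw [dist_zero_right, norm_mul, norm_div, norm_one, Complex.norm_natCast, one_div,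
      inv_mul_lt_iff₀ hNr, mul_one] at b1
    set V := ∑ n ∈ Finset.range N, ∑ k ∈ Finset.range H, u (n + k) with hV
    have c1 : ‖(H : ℂ) * ∑ n ∈ Finset.range N, u n - V‖ ≤ 2 * H * H := by
      rw [hV, Finset.sum_comm]
      have e : (H : ℂ) * ∑ n ∈ Finset.range N, u n
          = ∑ _k ∈ Finset.range H, ∑ n ∈ Finset.range N, u n := by simp
      rw [e, ← Finset.sum_sub_distrib]
      refine (norm_sum_le_of_le _ (fun k hk => ?_)).trans (b := ∑ _k ∈ Finset.range H, 2 * (H : ℝ)) ?_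
      · rw [← norm_neg, neg_sub, ← Finset.sum_sub_distrib]
        refine (norm_sum_range_shift_sub_le hu k N).trans ?_
        have : (k : ℝ) ≤ H := by exact_mod_cast (Finset.mem_range.mp hk).le
        linarith
      · simp; ring_nf; rfl
    have c2 : ‖V‖ ^ 2 ≤ N * (N * (H + 1)) := by
      refine (norm_sum_sq_le_card_mul _ _).trans ?_
      rw [Finset.card_range]
      refine mul_le_mul_of_nonneg_left ?_ hNr.le
      have e1 : ((∑ n ∈ Finset.range N, ‖∑ k ∈ Finset.range H, u (n + k)‖ ^ 2 : ℝ) : ℂ)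
          = ∑ kl ∈ Finset.range H ×ˢ Finset.range H, ∑ n ∈ Finset.range N,
              u (n + kl.1) * starRingEnd ℂ (u (n + kl.2)) := by
        rw [Finset.sum_comm]
        push_cast
        refine Finset.sum_congr rfl fun n _ => ?_
        rw [← Complex.mul_conj', map_sum, Finset.sum_mul_sum, Finset.sum_product]
      have e2 : ∑ kl ∈ Finset.range H ×ˢ Finset.range H, ∑ n ∈ Finset.range N,
              u (n + kl.1) * starRingEnd ℂ (u (n + kl.2))
          = ∑ n ∈ Finset.range N, ∑ kl ∈ Finset.range H ×ˢ Finset.range H,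
              (if kl.1 = kl.2 then 0 else u (n + kl.1) * starRingEnd ℂ (u (n + kl.2)))
            + ∑ n ∈ Finset.range N, ∑ k ∈ Finset.range H,
              u (n + k) * starRingEnd ℂ (u (n + k)) := by
        rw [Finset.sum_comm, ← Finset.sum_add_distrib]
        refine Finset.sum_congr rfl fun n _ => ?_
        have : ∑ k ∈ Finset.range H, u (n + k) * starRingEnd ℂ (u (n + k))
            = ∑ kl ∈ Finset.range H ×ˢ Finset.range H,
              (if kl.1 = kl.2 then u (n + kl.1) * starRingEnd ℂ (u (n + kl.2)) else 0) := by
          rw [Finset.sum_product]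
          refine Finset.sum_congr rfl fun k hk => ?_
          rw [Finset.sum_ite_eq, if_pos hk]
        rw [this, ← Finset.sum_add_distrib]
        refine Finset.sum_congr rfl fun kl _ => ?_
        split_ifs <;> simp
      have e3 : ‖∑ n ∈ Finset.range N, ∑ k ∈ Finset.range H,
          u (n + k) * starRingEnd ℂ (u (n + k))‖ ≤ N * H := by
        refine (norm_sum_le_of_le _ (fun n _ => norm_sum_le_of_le _ (fun k _ => hb k k n))).trans ?_
        simp
      have e4 : ∑ n ∈ Finset.range N, ‖∑ k ∈ Finset.range H, u (n + k)‖ ^ 2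
          = ‖((∑ n ∈ Finset.range N, ‖∑ k ∈ Finset.range H, u (n + k)‖ ^ 2 : ℝ) : ℂ)‖ := by
        rw [Complex.norm_real, Real.norm_of_nonneg (by positivity)]
      rw [e4, e1, e2]
      refine (norm_add_le _ _).trans ?_
      linarith
    have c3 : ‖V‖ ≤ √(H + 1) * N := by
      refine abs_le_of_sq_le_sq' ?_ (by positivity) |>.2
      rw [mul_pow, Real.sq_sqrt (by positivity)]
      linarith
    have c4 : H * ‖∑ n ∈ Finset.range N, u n‖ ≤ √(H + 1) * N + 2 * H * H := by
      have : (H : ℝ) * ‖∑ n ∈ Finset.range N, u n‖ = ‖(H : ℂ) * ∑ n ∈ Finset.range N, u n‖ := by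
        rw [norm_mul, Complex.norm_natCast]
      rw [this]
      have := norm_sub_norm_le ((H : ℂ) * ∑ n ∈ Finset.range N, u n) V
      linarith
    have : (√(H + 1) / H + 2 * H / N) * N = (√(H + 1) * N + 2 * H * H) / H := by
      field_simp
    rw [this, le_div_iff₀ hHr]
    linarith
  rw [CesaroNull, Metric.tendsto_atTop']
  intro ε hε
  obtain ⟨H, hH⟩ : ∃ H : ℕ, 0 < H ∧ √((H : ℝ) + 1) / H < ε / 2 := by
    -- Since `H > 1`, `H + 1 < 2H`, and `2H < (εH/2)²` as soon as `H > 8/ε²`.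
    obtain ⟨H, hH⟩ := exists_nat_gt (8 / ε ^ 2 + 1)
    have h8 : 0 < 8 / ε ^ 2 := by positivity
    have hH1 : (1 : ℝ) < H := by linarith
    refine ⟨H, by exact_mod_cast (lt_trans one_pos hH1), ?_⟩
    rw [div_lt_iff₀ (by linarith), Real.sqrt_lt' (by positivity)]
    have h9 : 8 / ε ^ 2 < H := by linarith
    rw [div_lt_iff₀ (by positivity)] at h9
    nlinarith
  have h2 : ∀ᶠ N : ℕ in atTop, 2 * (H : ℝ) / N < ε / 2 :=
    (tendsto_const_div_atTop_nhds_zero_nat (2 * (H : ℝ))).eventually_lt_const (by positivity)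
  obtain ⟨N₀, hN₀⟩ := eventually_atTop.mp
    ((key H hH.1).and (h2.and (eventually_gt_atTop 0)))
  refine ⟨N₀, fun N hN => ?_⟩
  obtain ⟨a1, a2, a3⟩ := hN₀ N hN.le
  have hNr : (0 : ℝ) < N := by exact_mod_cast a3
  rw [dist_zero_right, norm_mul, norm_div, norm_one, Complex.norm_natCast, one_div,
    inv_mul_lt_iff₀ hNr]
  refine lt_of_le_of_lt a1 ?_
  rw [mul_comm]
  exact mul_lt_mul_of_pos_left (by linarith [hH.2]) hNr

/-! ### Weyl's equidistribution theorem for polynomials -/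

/-- The character `θ ↦ exp(2πiθ)` of `ℝ/ℤ`. -/
noncomputable def phase (θ : UnitAddCircle) : ℂ := (AddCircle.toCircle θ : ℂ)

theorem norm_phase (θ : UnitAddCircle) : ‖phase θ‖ = 1 := Circle.norm_coe _

theorem phase_add (θ η : UnitAddCircle) : phase (θ + η) = phase θ * phase η := by
  simp [phase, AddCircle.toCircle_add]

theorem phase_zero : phase 0 = 1 := by simp [phase]

theorem phase_neg (θ : UnitAddCircle) : phase (-θ) = starRingEnd ℂ (phase θ) := by
  rw [phase, AddCircle.toCircle_neg, Circle.coe_inv_eq_conj, phase]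

theorem continuous_phase : Continuous phase :=
  continuous_subtype_val.comp AddCircle.continuous_toCircle

theorem phase_injective : Function.Injective phase :=
  Subtype.val_injective.comp (AddCircle.injective_toCircle one_ne_zero)

theorem phase_sum {ι : Type*} (s : Finset ι) (f : ι → UnitAddCircle) :
    phase (∑ i ∈ s, f i) = ∏ i ∈ s, phase (f i) := by
  classical
  induction s using Finset.induction_on with
  | empty => simp [phase_zero]
  | insert a s ha ih => rw [Finset.sum_insert ha, Finset.prod_insert ha, phase_add, ih]

theorem intCast_unitAddCircle (z : ℤ) : ((z : ℝ) : UnitAddCircle) = 0 :=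
  (AddCircle.coe_eq_zero_iff 1).mpr ⟨z, by simp⟩

theorem unitAddCircle_coe_eq_zero_iff (x : ℝ) :
    (x : UnitAddCircle) = 0 ↔ ∃ z : ℤ, (z : ℝ) = x := by
  rw [AddCircle.coe_eq_zero_iff]; simp

/-- Modulo 1 a rational polynomial is periodic on `ℕ`: a monomial has its denominator as a period.
The multiple `k` is carried along so that the periods of two summands can be multiplied. -/
theorem exists_period_mod_int (R : ℚ[X]) :
    ∃ M : ℕ, 0 < M ∧ ∀ k n : ℕ, ∃ z : ℤ,
      R.eval ((n : ℚ) + k * M) - R.eval (n : ℚ) = z := by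
  induction R using Polynomial.induction_on' with
  | add p q hp hq =>
    obtain ⟨M, hM, h1⟩ := hp
    obtain ⟨M', hM', h2⟩ := hq
    refine ⟨M * M', by positivity, fun k n => ?_⟩
    obtain ⟨z, hz⟩ := h1 (k * M') n
    obtain ⟨w, hw⟩ := h2 (k * M) n
    refine ⟨z + w, ?_⟩
    push_cast at hz hw ⊢
    rw [eval_add, eval_add, ← hz, ← hw]
    ring_nf
  | monomial i a =>
    refine ⟨a.den, a.den_pos, fun k n => ?_⟩
    have hdvd : ((k * a.den : ℕ) : ℤ) ∣ ((n + k * a.den : ℕ) : ℤ) ^ i - (n : ℤ) ^ i := by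
      have := sub_dvd_pow_sub_pow ((n + k * a.den : ℕ) : ℤ) (n : ℤ) i
      simpa using this
    obtain ⟨c, hc⟩ := hdvd
    refine ⟨a.num * k * c, ?_⟩
    have hc' : ((n : ℚ) + k * a.den) ^ i - (n : ℚ) ^ i = k * a.den * c := by exact_mod_cast hc
    rw [eval_monomial, eval_monomial, ← mul_sub, hc']
    push_cast
    have : a * a.den = a.num := Rat.mul_den_eq_num a
    linear_combination (k * c : ℚ) * this

/-- When `x` is a positive integer, the top coefficient gets multiplied by a positive integer, so
its irrationality survives the differencing in van der Corput's lemma. -/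
theorem coeff_taylor_sub {P : ℝ[X]} {j : ℕ} (hP : P.natDegree ≤ j + 1) (x : ℝ) :
    (taylor x P - P).coeff j = (j + 1) * P.coeff (j + 1) * x := by
  have h1 : (hasseDeriv j P).natDegree ≤ 1 := (natDegree_hasseDeriv_le _ _).trans (by omega)
  rw [coeff_sub, taylor_coeff, eval_eq_sum_range' (n := 2) (by omega)]
  simp [Finset.sum_range_succ, hasseDeriv_coeff, add_comm 1 j]

theorem natDegree_taylor_sub_le {P : ℝ[X]} {j : ℕ} (hP : P.natDegree ≤ j + 1) (x : ℝ) :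
    (taylor x P - P).natDegree ≤ j := by
  rw [natDegree_le_iff_coeff_eq_zero]
  intro i hi
  have hi' : P.natDegree ≤ i := by omega
  have h1 : (hasseDeriv i P).natDegree ≤ 0 := (natDegree_hasseDeriv_le _ _).trans (by omega)
  rw [coeff_sub, taylor_coeff, eval_eq_sum_range' (n := 1) (by omega)]
  simp [hasseDeriv_coeff]

/-- Induction on the degree of `P` by van der Corput. The rational part `R`, of any degree, is only
differenced along. For linear `P`, shifting by a period of `R` multiplies the sequence by a constant
`ζ ≠ 1`, so its partial sums are bounded. -/
theorem cesaroNull_phase_of_leading_irrational (j : ℕ) : ∀ (P : ℝ[X]) (R : ℚ[X]),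
    P.natDegree ≤ j + 1 → Irrational (P.coeff (j + 1)) →
    CesaroNull (fun n => phase ((P.eval (n : ℝ) + ((R.eval (n : ℚ) : ℚ) : ℝ) : ℝ))) := by
  induction j with
  | zero =>
    intro P R hP hirr
    obtain ⟨M, hM, hR⟩ := exists_period_mod_int R
    set u : ℕ → ℂ := fun n => phase ((P.eval (n : ℝ) + ((R.eval (n : ℚ) : ℚ) : ℝ) : ℝ))
    set ζ : ℂ := phase ((P.coeff 1 * M : ℝ))
    have hζ : ζ ≠ 1 := by
      intro h1
      rw [← phase_zero] at h1
      obtain ⟨z, hz⟩ := (unitAddCircle_coe_eq_zero_iff _).mp (phase_injective h1)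
      exact (hirr.mul_natCast hM.ne').ne_int z hz.symm
    have hu : ∀ n, u (n + M) = ζ * u n := by
      intro n
      obtain ⟨z, hz⟩ := hR 1 n
      simp only [u, ζ]
      rw [← phase_add, ← AddCircle.coe_add]
      congr 1
      rw [← sub_eq_zero, ← AddCircle.coe_sub, unitAddCircle_coe_eq_zero_iff]
      refine ⟨z, ?_⟩
      have hz' : ((R.eval ((n : ℚ) + M) : ℚ) : ℝ) - ((R.eval (n : ℚ) : ℚ) : ℝ) = z := by
        have : R.eval ((n : ℚ) + M) - R.eval (n : ℚ) = z := by simpa using hz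
        exact_mod_cast congrArg (fun q : ℚ => (q : ℝ)) this
      rw [eval_eq_sum_range' (p := P) (n := 2) (by omega),
        eval_eq_sum_range' (p := P) (n := 2) (by omega)]
      push_cast
      simp only [Finset.sum_range_succ, Finset.range_one, Finset.sum_singleton, pow_zero, pow_one]
      linear_combination -hz'
    have h1 : CesaroNull (fun n => (ζ - 1) * u n) := by
      refine cesaroNull_of_norm_sum_le (2 * M * 1) fun N => ?_
      have := norm_sum_range_shift_sub_le (u := u) (fun n => (norm_phase _).le) M N
      simpa only [hu, sub_mul, one_mul] using this
    have h2 := h1.const_mul (ζ - 1)⁻¹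
    simpa [← mul_assoc, inv_mul_cancel₀ (sub_ne_zero.mpr hζ)] using h2
  | succ j ih =>
    intro P R hP hirr
    refine cesaroNull_of_vanDerCorput (fun n => (norm_phase _).le) fun k hk => ?_
    have h1 := ih (taylor (k : ℝ) P - P) (taylor (k : ℚ) R - R) (natDegree_taylor_sub_le hP _) ?_
    · convert h1 using 2 with n
      rw [← phase_neg, ← phase_add, ← AddCircle.coe_neg, ← AddCircle.coe_add]
      congr 2
      rw [eval_sub, eval_sub, taylor_eval, taylor_eval]
      push_cast
      ring
    · rw [coeff_taylor_sub hP]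
      have := (hirr.natCast_mul (Nat.succ_ne_zero (j + 1))).mul_natCast hk.ne'
      push_cast at this ⊢
      exact this

/-- **Weyl's theorem**: if some non-constant coefficient of `Q` is irrational, then the averages of
`exp(2πi Q(n))` tend to `0`. -/
theorem cesaroNull_phase_of_irrational_coeff (Q : ℝ[X]) {k : ℕ} (hk : 1 ≤ k)
    (hirr : Irrational (Q.coeff k)) :
    CesaroNull (fun n => phase ((Q.eval (n : ℝ) : ℝ))) := by
  classical
  have hne : (Q.support.filter fun i => 1 ≤ i ∧ Irrational (Q.coeff i)).Nonempty :=
    ⟨k, by simp [hk, hirr, hirr.ne_zero]⟩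
  obtain ⟨m, hm, hmax⟩ := Finset.exists_max_image _ id hne
  simp only [Finset.mem_filter, mem_support_iff, id] at hm hmax
  obtain ⟨j, rfl⟩ : ∃ j, m = j + 1 := ⟨m - 1, by omega⟩
  -- `j + 1` is the largest degree with an irrational coefficient. Truncating there leaves a
  -- remainder with rational coefficients, which plays the role of `R`.
  set P : ℝ[X] := ∑ i ∈ Finset.range (j + 2), monomial i (Q.coeff i) with hPdef
  have hPc : ∀ i, P.coeff i = if i < j + 2 then Q.coeff i else 0 := by
    intro i
    simp [hPdef, coeff_monomial]
  have hlift : Q - P ∈ lifts (algebraMap ℚ ℝ) := by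
    rw [lifts_iff_coeff_lifts]
    intro i
    rw [coeff_sub, hPc]
    split_ifs with hi
    · exact ⟨0, by simp⟩
    · by_contra hcon
      have h1 : Irrational (Q.coeff i) := by
        rintro ⟨q, hq⟩
        exact hcon ⟨q, by simp [hq]⟩
      have := hmax i ⟨h1.ne_zero, by omega, h1⟩
      omega
  obtain ⟨R, hR⟩ := (mem_lifts _).mp hlift
  have h1 := cesaroNull_phase_of_leading_irrational j P R ?_ ?_
  · convert h1 using 4 with n
    have : ((R.eval (n : ℚ) : ℚ) : ℝ) = (R.map (algebraMap ℚ ℝ)).eval (n : ℝ) := by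
      have := eval_map_apply (p := R) (algebraMap ℚ ℝ) (n : ℚ)
      simpa using this.symm
    rw [this, hR]
    simp
  · rw [natDegree_le_iff_coeff_eq_zero]
    intro i hi
    rw [hPc, if_neg (by omega)]
  · rw [hPc, if_pos (by omega)]
    exact hm.2.2

/-! ### Phase polynomials of a homeomorphism -/

section PolyPhases

variable {X : Type*} [TopologicalSpace X]

/-- The difference operator `f ↦ f ∘ T - f` on continuous functions with values in `ℝ/ℤ`. -/
def diffOp (T : X ≃ₜ X) : AddMonoid.End C(X, UnitAddCircle) where
  toFun f := f.comp (T : C(X, X)) - f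
  map_zero' := by ext; simp
  map_add' f g := by ext x; simp; abel

theorem diffOp_apply (T : X ≃ₜ X) (f : C(X, UnitAddCircle)) (x : X) :
    diffOp T f x = f (T x) - f x := rfl

/-- The functions `f` with `Δ^(d+1) f = 0`, that is, for which `f(T^n x)` is a polynomial in `n` of
degree at most `d`. -/
def polyPhases (T : X ≃ₜ X) (d : ℕ) : AddSubgroup C(X, UnitAddCircle) :=
  AddMonoidHom.ker (diffOp T ^ (d + 1) : AddMonoid.End C(X, UnitAddCircle))

theorem mem_polyPhases {T : X ≃ₜ X} {d : ℕ} {f : C(X, UnitAddCircle)} :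
    f ∈ polyPhases T d ↔ (diffOp T ^ (d + 1)) f = 0 := Iff.rfl

theorem diffOp_pow_succ_apply (T : X ≃ₜ X) (i : ℕ) (f : C(X, UnitAddCircle)) :
    (diffOp T ^ (i + 1)) f = (diffOp T ^ i) (diffOp T f) := by
  rw [pow_succ]; rfl

theorem diffOp_pow_add_apply (T : X ≃ₜ X) (i j : ℕ) (f : C(X, UnitAddCircle)) :
    (diffOp T ^ (i + j)) f = (diffOp T ^ i) ((diffOp T ^ j) f) := by
  rw [pow_add]; rfl

theorem diffOp_pow_eq_zero {T : X ≃ₜ X} {d : ℕ} {f : C(X, UnitAddCircle)}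
    (hf : f ∈ polyPhases T d) {i : ℕ} (hi : d + 1 ≤ i) : (diffOp T ^ i) f = 0 := by
  obtain ⟨k, rfl⟩ := Nat.exists_eq_add_of_le' hi
  rw [diffOp_pow_add_apply, mem_polyPhases.mp hf, map_zero]

theorem diffOp_pow_mem {T : X ≃ₜ X} {d : ℕ} {f : C(X, UnitAddCircle)}
    (hf : f ∈ polyPhases T d) (i : ℕ) : (diffOp T ^ i) f ∈ polyPhases T d := by
  rw [mem_polyPhases, ← diffOp_pow_add_apply]
  exact diffOp_pow_eq_zero hf (by omega)

/-- Newton's forward difference formula. By Pascal's rule and the case of `diffOp T f`, both sides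
have the same increments in `n`, and they agree at `n = 0`; this runs through negative `n` as well.
-/
theorem polyPhase_apply_zpow (T : X ≃ₜ X) (d : ℕ) : ∀ f ∈ polyPhases T d, ∀ (n : ℤ) (x : X),
    f ((T ^ n) x) = ∑ i ∈ Finset.range (d + 1), Ring.choose n i • (diffOp T ^ i) f x := by
  induction d with
  | zero =>
    intro f hf n x
    have h1 : ∀ y, f (T y) = f y := fun y => by
      have := DFunLike.congr_fun (mem_polyPhases.mp hf) y
      simpa [diffOp_apply, sub_eq_zero] using this
    have h2 : ∀ n : ℤ, f ((T ^ n) x) = f x := by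
      intro n
      induction n using Int.induction_on with
      | zero => simp
      | succ n ih =>
        rw [add_comm, zpow_one_add, Homeomorph.mul_apply, h1, ih]
      | pred n ih =>
        rw [← ih, ← h1]
        congr 1
        rw [← Homeomorph.mul_apply, ← zpow_one_add]
        congr 2; ring
    simp [h2]
  | succ d ih =>
    intro f hf n x
    have hD : diffOp T f ∈ polyPhases T d := by
      rw [mem_polyPhases, ← diffOp_pow_succ_apply]; exact hf
    have step : ∀ n : ℤ, f ((T ^ (n + 1)) x) - f ((T ^ n) x)
        = ∑ i ∈ Finset.range (d + 2), Ring.choose (n + 1) i • (diffOp T ^ i) f x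
          - ∑ i ∈ Finset.range (d + 2), Ring.choose n i • (diffOp T ^ i) f x := by
      intro n
      have h1 := ih (diffOp T f) hD n x
      rw [diffOp_apply, ← Homeomorph.mul_apply, ← zpow_one_add, add_comm 1 n] at h1
      rw [h1, Finset.sum_range_succ' _ (d + 1), Finset.sum_range_succ' _ (d + 1)]
      simp only [Ring.choose_zero_right, Ring.choose_succ_succ, add_smul, Finset.sum_add_distrib,
        diffOp_pow_succ_apply]
      abel
    induction n using Int.induction_on with
    | zero =>
      rw [Finset.sum_range_succ']
      simp [Ring.choose_zero_succ]
    | succ n ih' =>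
      have := step n
      rw [ih', sub_left_inj] at this
      exact this
    | pred n ih' =>
      have := step (-n - 1)
      rw [sub_add_cancel, ih', sub_right_inj] at this
      exact this

end PolyPhases

/-! ### Binomial polynomials -/

/-- `binom(p, k)` with rational coefficients. -/
noncomputable def ratBinomPoly (p : ℚ[X]) (k : ℕ) : ℚ[X] :=
  C ((k.factorial : ℚ)⁻¹) * (descPochhammer ℚ k).comp p

theorem map_ratBinomPoly (p : ℚ[X]) (k : ℕ) :
    (ratBinomPoly p k).map (algebraMap ℚ ℝ) = binomPoly p k := by
  rw [ratBinomPoly, binomPoly, Polynomial.map_mul, map_C, map_comp, descPochhammer_map]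
  simp

theorem eval_descPochhammer_intCast (z : ℤ) (k : ℕ) :
    (descPochhammer ℚ k).eval (z : ℚ) = k.factorial * (Ring.choose z k : ℤ) := by
  have h1 := Ring.descPochhammer_eq_factorial_smul_choose z k
  rw [← eval_eq_smeval, nsmul_eq_mul] at h1
  have h2 : ((descPochhammer ℤ k).map (Int.castRingHom ℚ)).eval (z : ℚ)
      = (((descPochhammer ℤ k).eval z : ℤ) : ℚ) := by
    rw [eval_intCast_map, eq_intCast]
    simp
  rw [descPochhammer_map] at h2
  rw [h2, h1]
  push_cast
  rfl

theorem eval_ratBinomPoly {p : ℚ[X]} (hp : IsIntegralPoly p) (k : ℕ) (n : ℤ) :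
    (ratBinomPoly p k).eval (n : ℚ) = ((Ring.choose (intValue p n) k : ℤ) : ℚ) := by
  rw [ratBinomPoly, eval_mul, eval_C, eval_comp, ← intValue_spec hp, eval_descPochhammer_intCast,
    inv_mul_cancel_left₀ (by positivity)]

theorem eval_binomPoly {p : ℚ[X]} (hp : IsIntegralPoly p) (k : ℕ) (n : ℤ) :
    (binomPoly p k).eval (n : ℝ) = ((Ring.choose (intValue p n) k : ℤ) : ℝ) := by
  have h1 := eval_map_apply (p := ratBinomPoly p k) (algebraMap ℚ ℝ) (n : ℚ)
  rw [map_ratBinomPoly, eval_ratBinomPoly hp] at h1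
  simpa using h1

theorem coeff_zero_ratBinomPoly {p : ℚ[X]} (hp0 : p.eval 0 = 0) (k : ℕ) :
    (ratBinomPoly p (k + 1)).coeff 0 = 0 := by
  rw [coeff_zero_eq_eval_zero, ratBinomPoly, eval_mul, eval_comp, hp0,
    descPochhammer_ne_zero_eval_zero _ (Nat.succ_ne_zero k), mul_zero]

/-- The sum is a polynomial in `n` with infinitely many roots, hence zero. Evaluation at `n = l`
then isolates `b l`, because larger binomials vanish there and smaller indices are already settled.
-/
theorem eq_zero_of_frequently_sum_choose_eq_zero {d : ℕ} {b : ℕ → ℚ}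
    (h : ∃ᶠ n : ℕ in atTop, ∑ l ∈ Finset.range (d + 1), (n.choose l : ℚ) * b l = 0) :
    ∀ l ≤ d, b l = 0 := by
  set G : ℚ[X] := ∑ l ∈ Finset.range (d + 1), C (b l) * (ratBinomPoly X l) with hG
  have hev : ∀ n : ℕ, G.eval (n : ℚ) = ∑ l ∈ Finset.range (d + 1), (n.choose l : ℚ) * b l := by
    intro n
    rw [hG, eval_finsetSum]
    refine Finset.sum_congr rfl fun l _ => ?_
    have h1 := eval_descPochhammer_intCast (n : ℤ) l
    rw [Ring.choose_natCast] at h1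
    push_cast at h1
    rw [ratBinomPoly, comp_X, eval_mul, eval_mul, eval_C, eval_C, h1,
      inv_mul_cancel_left₀ (by positivity), mul_comm]
  have hG0 : G = 0 := by
    refine eq_zero_of_infinite_isRoot G ?_
    have := Nat.frequently_atTop_iff_infinite.mp h
    refine (this.image (f := fun n : ℕ => (n : ℚ)) Nat.cast_injective.injOn).mono ?_
    rintro _ ⟨n, hn, rfl⟩
    simpa [IsRoot, hev] using hn
  intro l
  induction l using Nat.strong_induction_on with
  | _ l ih =>
    intro hl
    have h1 := hev l
    rw [hG0, eval_zero, Finset.sum_eq_single l] at h1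
    · simpa using h1.symm
    · intro i hi hil
      rcases lt_or_gt_of_ne hil with h2 | h2
      · rw [ih i h2 (by omega), mul_zero]
      · rw [Nat.choose_eq_zero_of_lt h2]; simp
    · intro h2; simp at h2; omega

/-! ### A rational functional detecting an irrational number -/

/-- `α` lies outside the `ℚ`-line of `1`, so some functional kills that line and not `α`. Killing
`ℤ`, it descends to `ℝ/ℤ`. -/
theorem exists_rat_functional {α : ℝ} (hα : Irrational α) :
    ∃ (L : ℝ →ₗ[ℚ] ℚ) (lam : UnitAddCircle →+ ℚ), (∀ q : ℚ, L q = 0) ∧ L α ≠ 0 ∧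
      ∀ t : ℝ, lam t = L t := by
  have h1 : α ∉ Submodule.span ℚ {(1 : ℝ)} := by
    rw [Submodule.mem_span_singleton]
    rintro ⟨q, hq⟩
    exact hα ⟨q, by simpa [Algebra.smul_def] using hq⟩
  obtain ⟨L, hL, hker⟩ := Submodule.exists_le_ker_of_notMem h1
  have hL1 : L 1 = 0 := hker (Submodule.mem_span_singleton_self 1)
  have hLq : ∀ q : ℚ, L q = 0 := by
    intro q
    have : (q : ℝ) = q • (1 : ℝ) := by simp [Algebra.smul_def]
    rw [this, map_smul, hL1, smul_zero]
  refine ⟨L, QuotientAddGroup.lift (AddSubgroup.zmultiples (1 : ℝ)) L.toAddMonoidHom ?_,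
    hLq, hL, fun t => rfl⟩
  rintro _ ⟨z, rfl⟩
  simpa using hLq z

/-! ### Weyl polynomials from vanishing shifts -/

/-- The vector `v` has entries `-a j i / c`. Relation `h0` says that it represents `h`. The relation
with shift `l + 1` says that its lower blocks are orthogonal to column `l` (counted from `0`) of
`Λ_{d-1}`, at every point `y`. -/
theorem mem_weylPolys_of_shifts_eq_zero {r d : ℕ} (hd : 1 ≤ d) {p : Fin r → ℚ[X]}
    (a : Fin r → ℕ → ℚ) (ha : ∀ j i, d < i → a j i = 0) {c : ℚ} (hc : c ≠ 0) {h : ℚ[X]}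
    (h0 : C c * h + ∑ j, ∑ i ∈ Finset.range d, C (a j (i + 1)) * ratBinomPoly (p j) (i + 1) = 0)
    (hl : ∀ l, 1 ≤ l → l ≤ d →
      ∑ j, ∑ i ∈ Finset.range d, C (a j (i + 1 + l)) * ratBinomPoly (p j) (i + 1) = 0) :
    h.map (algebraMap ℚ ℝ) ∈ weylPolys p d := by
  obtain ⟨k, rfl⟩ : ∃ k, d = k + 1 := ⟨d - 1, by omega⟩
  have hmap : ∀ l, (∑ j, ∑ i ∈ Finset.range (k + 1),
      C (a j (i + 1 + l)) * ratBinomPoly (p j) (i + 1)).map (algebraMap ℚ ℝ)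
      = ∑ j, ∑ i ∈ Finset.range (k + 1), C (a j (i + 1 + l) : ℝ) * binomPoly (p j) (i + 1) := by
    intro l
    simp [Polynomial.map_sum, map_ratBinomPoly]
  have hcR : (c : ℝ) ≠ 0 := by exact_mod_cast hc
  refine ⟨fun ij => -((c : ℝ)⁻¹ * a ij.2 (ij.1 + 1)), ?_, ?_⟩
  · intro w hw
    induction hw using Submodule.span_induction with
    | mem w hw =>
      obtain ⟨l, y, rfl⟩ := hw
      have h1 := hmap (l + 1)
      rw [hl (l + 1) (by omega) (by omega), Polynomial.map_zero] at h1
      have h2 := congrArg (eval y) h1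
      simp only [eval_zero, eval_finsetSum, eval_mul, eval_C] at h2
      rw [Fintype.sum_prod_type_right]
      have h3 : ∀ j, ∑ i : Fin k, -((c : ℝ)⁻¹ * a j ((i.succ : ℕ) + 1)) *
            (weylMatrix p k (i, j) l).eval y
          = -(c : ℝ)⁻¹ * ∑ i ∈ Finset.range (k + 1),
              (a j (i + 1 + (l + 1)) : ℝ) * (binomPoly (p j) (i + 1)).eval y := by
        intro j
        rw [Finset.mul_sum]
        set F : ℕ → ℝ := fun i => if (l : ℕ) ≤ i then
          -((c : ℝ)⁻¹ * a j (i + 2)) * (binomPoly (p j) (i - l + 1)).eval y else 0 with hF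
        have e1 : ∑ i : Fin k, -((c : ℝ)⁻¹ * a j ((i.succ : ℕ) + 1)) *
            (weylMatrix p k (i, j) l).eval y = ∑ i ∈ Finset.range k, F i := by
          rw [← Fin.sum_univ_eq_sum_range]
          refine Finset.sum_congr rfl fun i _ => ?_
          simp only [weylMatrix, hF, Fin.le_def, Fin.val_succ]
          split_ifs <;> simp
        have e2 : ∑ i ∈ Finset.range k, F i = ∑ i ∈ Finset.Ico (l : ℕ) k, F i := by
          refine (Finset.sum_subset (fun i hi => ?_) fun i _ hi2 => ?_).symm
          · simp at hi ⊢; omega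
          · simp only [Finset.mem_Ico, not_and, not_lt] at hi2
            rw [hF]
            dsimp only
            rw [if_neg]
            simp_all
            omega
        -- After the substitution `i ↦ l + i` the two sums differ only in terms whose index for `a
        -- j` exceeds `d`.
        rw [e1, e2, Finset.sum_Ico_eq_sum_range]
        refine Finset.sum_subset_zero_on_sdiff (fun i hi => ?_) (fun i hi => ?_) fun i hi => ?_
        · simp at hi ⊢; omega
        · simp only [Finset.mem_sdiff, Finset.mem_range, not_lt] at hi
          rw [ha j _ (by omega)]
          simp
        · rw [hF]
          dsimp only
          rw [if_pos (by omega), show (l : ℕ) + i - l = i by omega,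
            show (l : ℕ) + i + 2 = i + 1 + (l + 1) by omega]
          ring
      rw [Finset.sum_congr rfl fun j _ => h3 j, ← Finset.mul_sum, ← h2, mul_zero]
    | zero => simp
    | add u v _ _ hu hv =>
      simp only [Pi.add_apply, mul_add, Finset.sum_add_distrib]
      rw [hu, hv, add_zero]
    | smul t u _ hu =>
      simp only [Pi.smul_apply, smul_eq_mul, mul_left_comm _ t, ← Finset.mul_sum]
      rw [hu, mul_zero]
  · have h1 := congrArg (Polynomial.map (algebraMap ℚ ℝ)) h0
    have h2 := hmap 0
    simp only [add_zero] at h2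
    rw [Polynomial.map_add, h2, Polynomial.map_zero, Polynomial.map_mul, map_C] at h1
    have h3 : h.map (algebraMap ℚ ℝ) = C (-(c : ℝ)⁻¹) * ∑ j, ∑ i ∈ Finset.range (k + 1),
        C (a j (i + 1) : ℝ) * binomPoly (p j) (i + 1) := by
      have h4 : C (c : ℝ) * h.map (algebraMap ℚ ℝ) = -∑ j, ∑ i ∈ Finset.range (k + 1),
        C (a j (i + 1) : ℝ) * binomPoly (p j) (i + 1) := eq_neg_of_add_eq_zero_left (by simpa using h1)
      rw [C_neg, neg_mul, ← mul_neg, ← h4, ← mul_assoc, ← C_mul, inv_mul_cancel₀ hcR, C_1, one_mul]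
    rw [h3, Fintype.sum_prod_type_right, Finset.mul_sum]
    refine Finset.sum_congr rfl fun j _ => ?_
    rw [Finset.mul_sum, ← Fin.sum_univ_eq_sum_range]
    refine Finset.sum_congr rfl fun i _ => ?_
    rw [← mul_assoc, ← C_mul]
    congr 1
    simp

theorem unitAddCircle_coe_sum {ι : Type*} (s : Finset ι) (f : ι → ℝ) :
    ((∑ i ∈ s, f i : ℝ) : UnitAddCircle) = ∑ i ∈ s, (f i : UnitAddCircle) :=
  map_sum (QuotientAddGroup.mk' (AddSubgroup.zmultiples (1 : ℝ))) f s

/-! ### Pointwise averages along a phase polynomial -/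

section Pointwise

variable {X : Type*} [TopologicalSpace X]

/-- With real lifts `θ` of the differences at `x`, the phase is the value of a real polynomial `Q`.
By Weyl's theorem its non-constant coefficients are rational, hence killed by `L`; read off
coefficientwise, this is the relation. -/
theorem rat_relation_of_not_cesaroNull {T : X ≃ₜ X} {r d : ℕ} {p : Fin r → ℚ[X]}
    (hp : ∀ j, IsIntegralPoly (p j)) (hp0 : ∀ j, (p j).eval 0 = 0)
    {h : ℚ[X]} (hh : IsIntegralPoly h) (hh0 : h.eval 0 = 0) {α : ℝ}
    {L : ℝ →ₗ[ℚ] ℚ} {lam : UnitAddCircle →+ ℚ} (hL : ∀ q : ℚ, L q = 0)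
    (hlam : ∀ t : ℝ, lam t = L t) (m : ℤ) {f : Fin r → C(X, UnitAddCircle)}
    (hf : ∀ j, f j ∈ polyPhases T d) {x : X}
    (hx : ¬ CesaroNull (fun n => phase (m • (((intValue h n : ℝ) * α : ℝ) : UnitAddCircle) +
      ∑ j, f j ((T ^ intValue (p j) n) x)))) :
    C (m * L α) * h + ∑ j, ∑ i ∈ Finset.range d,
      C (lam ((diffOp T ^ (i + 1)) (f j) x)) * ratBinomPoly (p j) (i + 1) = 0 := by
  choose θ hθ using fun j i => QuotientAddGroup.mk_surjective ((diffOp T ^ i) (f j) x)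
  replace hθ : ∀ j i, ((θ j i : ℝ) : UnitAddCircle) = (diffOp T ^ i) (f j) x := hθ
  set Q : ℝ[X] := C (∑ j, θ j 0) + (C (m * α) * h.map (algebraMap ℚ ℝ) +
    ∑ j, ∑ i ∈ Finset.range d, C (θ j (i + 1)) * binomPoly (p j) (i + 1)) with hQ
  have hval : ∀ n : ℕ, ((Q.eval (n : ℝ) : ℝ) : UnitAddCircle)
      = m • (((intValue h n : ℝ) * α : ℝ) : UnitAddCircle) +
        ∑ j, f j ((T ^ intValue (p j) n) x) := by
    intro n
    have e1 : (h.map (algebraMap ℚ ℝ)).eval (n : ℝ) = (intValue h n : ℝ) := by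
      have h1 := eval_map_apply (p := h) (algebraMap ℚ ℝ) (n : ℚ)
      have h2 := intValue_spec hh n
      rw [Int.cast_natCast] at h2
      rw [← h2] at h1
      simpa using h1
    have e2 : ∀ j, f j ((T ^ intValue (p j) n) x) = ((θ j 0 +
        ∑ i ∈ Finset.range d, θ j (i + 1) * (binomPoly (p j) (i + 1)).eval (n : ℝ) : ℝ) :
          UnitAddCircle) := by
      intro j
      rw [polyPhase_apply_zpow T d (f j) (hf j), Finset.sum_range_succ', AddCircle.coe_add, add_comm,
        unitAddCircle_coe_sum]
      congr 1
      · rw [hθ]; simp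
      · refine Finset.sum_congr rfl fun i _ => ?_
        have := eval_binomPoly (hp j) (i + 1) n
        rw [Int.cast_natCast] at this
        rw [this, ← hθ, mul_comm, ← zsmul_eq_mul, AddCircle.coe_zsmul]
    rw [Finset.sum_congr rfl fun j _ => e2 j, ← AddCircle.coe_zsmul, ← unitAddCircle_coe_sum,
      ← AddCircle.coe_add]
    congr 1
    simp only [hQ, eval_add, eval_C, eval_mul, eval_finsetSum, e1, Finset.sum_add_distrib,
      zsmul_eq_mul]
    ring
  simp only [← hval] at hx
  ext k
  -- Weyl's theorem says nothing about the constant coefficient; there the relation holds because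
  -- `h` and all `p j` vanish at `0`.
  rcases Nat.eq_zero_or_pos k with rfl | hk
  · simp only [coeff_add, coeff_C_mul, finsetSum_coeff, coeff_zero_ratBinomPoly (hp0 _), coeff_zero,
      coeff_zero_eq_eval_zero h, hh0, mul_zero, Finset.sum_const_zero, add_zero]
  · have hrat : ¬ Irrational (Q.coeff k) := fun hirr =>
      hx (cesaroNull_phase_of_irrational_coeff Q hk hirr)
    obtain ⟨q, hq⟩ := not_not.mp hrat
    have h1 := hL q
    rw [hq, hQ] at h1
    have hb : ∀ p i, (binomPoly p i).coeff k = ((ratBinomPoly p i).coeff k : ℝ) := by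
      intro p i
      rw [← map_ratBinomPoly, coeff_map]; rfl
    have hLm : ∀ (t : ℝ) (q : ℚ), L (t * q) = L t * q := by
      intro t q
      rw [mul_comm, ← Rat.smul_def, map_smul, smul_eq_mul, mul_comm]
    simp only [coeff_add, coeff_C_mul, finsetSum_coeff, coeff_map, coeff_C, hk.ne', if_false,
      zero_add, hb, map_add, map_sum, Finset.sum_const_zero, hLm, eq_ratCast] at h1
    simp only [coeff_add, coeff_C_mul, finsetSum_coeff, coeff_zero, ← hθ, hlam]
    rw [← h1]
    congr 2
    have := hLm α m
    rw [mul_comm] at this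
    push_cast at this
    rw [this, mul_comm]

/-- If the exceptional set had positive measure, a point returning to it infinitely often would
carry rational relations at infinitely many `T^n x`. Comparing their coefficients as polynomials in
`n` would make `h` a Weyl polynomial. -/
theorem ae_cesaroNull_of_notMem_weylPolys [MeasurableSpace X] [BorelSpace X] {μ : Measure X}
    [IsFiniteMeasure μ] {T : X ≃ₜ X} (hT : MeasurePreserving T μ μ) {r d : ℕ} (hd : 1 ≤ d)
    {p : Fin r → ℚ[X]} (hp : ∀ j, IsIntegralPoly (p j)) (hp0 : ∀ j, (p j).eval 0 = 0)
    {h : ℚ[X]} (hh : IsIntegralPoly h) (hh0 : h.eval 0 = 0)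
    (hWP : h.map (algebraMap ℚ ℝ) ∉ weylPolys p d) {α : ℝ} (hα : Irrational α)
    {m : ℤ} (hm : m ≠ 0) {f : Fin r → C(X, UnitAddCircle)} (hf : ∀ j, f j ∈ polyPhases T d) :
    ∀ᵐ x ∂μ, CesaroNull (fun n => phase (m • (((intValue h n : ℝ) * α : ℝ) : UnitAddCircle) +
      ∑ j, f j ((T ^ intValue (p j) n) x))) := by
  obtain ⟨L, lam, hL, hLα, hlam⟩ := exists_rat_functional hα
  set B : Set X := {x | CesaroNull (fun n => phase (m • (((intValue h n : ℝ) * α : ℝ) :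
    UnitAddCircle) + ∑ j, f j ((T ^ intValue (p j) n) x)))}ᶜ with hB
  have hcont : ∀ N : ℕ, Continuous fun x => (1 / (N : ℂ)) * ∑ n ∈ Finset.range N,
      phase (m • (((intValue h n : ℝ) * α : ℝ) : UnitAddCircle) +
        ∑ j, f j ((T ^ intValue (p j) n) x)) := by
    intro N
    refine continuous_const.mul (continuous_finsetSum _ fun n _ => continuous_phase.comp
      (continuous_const.add (continuous_finsetSum _ fun j _ =>
        (f j).continuous.comp (Homeomorph.continuous _))))
  have hBm : MeasurableSet B :=
    (measurableSet_tendsto (𝓝 (0 : ℂ)) fun N => (hcont N).measurable).compl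
  by_contra hcon
  have hBpos : μ B ≠ 0 := fun h0 => hcon (measure_eq_zero_iff_ae_notMem.mp h0 |>.mono
    fun x hx => not_not.mp hx)
  obtain ⟨x, -, hxf⟩ := (hT.conservative.frequently_ae_mem_and_frequently_image_mem
    hBm.nullMeasurableSet hBpos).exists
  set a : Fin r → ℕ → ℚ := fun j i => lam ((diffOp T ^ i) (f j) x) with ha
  set E : ℕ → ℚ[X] := fun l => ∑ j, ∑ i ∈ Finset.range d,
    C (a j (i + 1 + l)) * ratBinomPoly (p j) (i + 1) with hE
  -- Newton's formula expands `Δ^(i+1) f_j` at `T^n x` into the higher differences at `x`, which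
  -- shifts the index of `a` by `l`.
  have hrel : ∃ᶠ n : ℕ in atTop, C (m * L α) * h +
      ∑ l ∈ Finset.range (d + 1), C ((n.choose l : ℚ)) * E l = 0 := by
    refine hxf.mono fun n hn => ?_
    have h1 := rat_relation_of_not_cesaroNull hp hp0 hh hh0 hL hlam m hf hn
    rw [← h1]
    congr 1
    simp only [hE, Finset.mul_sum]
    rw [Finset.sum_comm]
    refine Finset.sum_congr rfl fun j _ => ?_
    rw [Finset.sum_comm]
    refine Finset.sum_congr rfl fun i _ => ?_
    have hit : T^[n] x = (T ^ (n : ℤ)) x := by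
      rw [zpow_natCast]
      clear hn h1
      induction n with
      | zero => rfl
      | succ n ih => rw [Function.iterate_succ_apply', ih, pow_succ', Homeomorph.mul_apply]
    rw [hit, polyPhase_apply_zpow T d _ (diffOp_pow_mem (hf j) _), map_sum, map_sum, Finset.sum_mul]
    refine Finset.sum_congr rfl fun l _ => ?_
    rw [map_zsmul, Ring.choose_natCast, ← mul_assoc, ← C_mul, ← diffOp_pow_add_apply,
      add_comm l (i + 1)]
    simp [ha]
  have hzero : ∀ k : ℕ, ∀ l ≤ d, (if l = 0 then (C (m * L α) * h).coeff k else 0)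
      + (E l).coeff k = 0 := by
    intro k
    refine eq_zero_of_frequently_sum_choose_eq_zero (hrel.mono fun n hn => ?_)
    have := congrArg (fun P : ℚ[X] => P.coeff k) hn
    simp only [coeff_add, finsetSum_coeff, coeff_C_mul, coeff_zero] at this ⊢
    simp only [mul_add, Finset.sum_add_distrib, mul_ite, mul_zero, Finset.sum_ite_eq',
      Finset.mem_range, Nat.succ_pos, if_true, Nat.choose_zero_right, Nat.cast_one, one_mul]
    exact this
  refine hWP (mem_weylPolys_of_shifts_eq_zero hd a (fun j i hi => ?_)
    (mul_ne_zero (Int.cast_ne_zero.mpr hm) hLα) (c := m * L α) ?_ fun l hl hld => ?_)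
  · rw [ha]
    dsimp only
    rw [diffOp_pow_eq_zero (hf j) hi]
    simp
  · ext k
    have := hzero k 0 (Nat.zero_le _)
    rw [if_pos rfl, ← coeff_add] at this
    simpa only [hE, add_zero, coeff_zero] using this
  · ext k
    have := hzero k l hld
    rw [if_neg (by omega), zero_add] at this
    simpa only [coeff_zero] using this

end Pointwise

/-! ### Winding numbers -/

theorem exists_real_lift {A : Type*} [TopologicalSpace A] [SimplyConnectedSpace A]
    [LocallyPathConnectedSpace A] (q : C(A, UnitAddCircle)) (a : A) (t : ℝ)
    (ht : (t : UnitAddCircle) = q a) :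
    ∃ Q : C(A, ℝ), Q a = t ∧ ∀ x, (Q x : UnitAddCircle) = q x := by
  obtain ⟨Q, ⟨h1, h2⟩, -⟩ :=
    (AddCircle.isCoveringMap_coe (1 : ℝ)).existsUnique_continuousMap_lifts q a t ht
  exact ⟨Q, h1, fun x => congrFun h2 x⟩

theorem real_lift_unique {A : Type*} [TopologicalSpace A] [SimplyConnectedSpace A]
    [LocallyPathConnectedSpace A] {q : C(A, UnitAddCircle)} {a : A} {Q Q' : C(A, ℝ)}
    (ha : Q a = Q' a) (hQ : ∀ x, (Q x : UnitAddCircle) = q x)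
    (hQ' : ∀ x, (Q' x : UnitAddCircle) = q x) : Q = Q' :=
  ((AddCircle.isCoveringMap_coe (1 : ℝ)).existsUnique_continuousMap_lifts q a (Q a)
    (hQ a)).unique ⟨rfl, funext hQ⟩ ⟨ha.symm, funext hQ'⟩

theorem exists_real_lift' {A : Type*} [TopologicalSpace A] [SimplyConnectedSpace A]
    [LocallyPathConnectedSpace A] (q : C(A, UnitAddCircle)) :
    ∃ Q : C(A, ℝ), ∀ x, (Q x : UnitAddCircle) = q x := by
  obtain ⟨a⟩ : Nonempty A := PathConnectedSpace.nonempty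
  obtain ⟨t, ht⟩ := QuotientAddGroup.mk_surjective (q a)
  obtain ⟨Q, -, hQ⟩ := exists_real_lift q a t ht
  exact ⟨Q, hQ⟩

/-- The total variation over `[0, 1]` of a continuous lift of `q : ℝ → ℝ/ℤ` to `ℝ`. -/
noncomputable def winding (q : C(ℝ, UnitAddCircle)) : ℝ :=
  (exists_real_lift' q).choose 1 - (exists_real_lift' q).choose 0

theorem winding_eq {q : C(ℝ, UnitAddCircle)} {Q : C(ℝ, ℝ)}
    (hQ : ∀ t, (Q t : UnitAddCircle) = q t) : winding q = Q 1 - Q 0 := by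
  set P := (exists_real_lift' q).choose with hP
  have hPq : ∀ t, (P t : UnitAddCircle) = q t := (exists_real_lift' q).choose_spec
  have h0 : ((Q 0 - P 0 : ℝ) : UnitAddCircle) = 0 := by
    rw [AddCircle.coe_sub, hQ, hPq, sub_self]
  have h1 : P + ContinuousMap.const ℝ (Q 0 - P 0) = Q :=
    real_lift_unique (q := q) (a := 0) (by simp) (fun t => by
      rw [ContinuousMap.add_apply, ContinuousMap.const_apply, AddCircle.coe_add, h0, hPq, add_zero])
      hQ
  rw [winding, ← hP, ← h1]
  simp
  ring

theorem winding_sub (q q' : C(ℝ, UnitAddCircle)) : winding (q - q') = winding q - winding q' := by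
  obtain ⟨Q, hQ⟩ := exists_real_lift' q
  obtain ⟨Q', hQ'⟩ := exists_real_lift' q'
  rw [winding_eq hQ, winding_eq hQ', winding_eq (Q := Q - Q') fun t => by simp [hQ, hQ']]
  simp; ring

theorem winding_const (θ : UnitAddCircle) : winding (ContinuousMap.const ℝ θ) = 0 := by
  obtain ⟨t, ht⟩ := QuotientAddGroup.mk_surjective θ
  rw [winding_eq (q := ContinuousMap.const ℝ θ) (Q := ContinuousMap.const ℝ t) fun _ => ht]
  simp

/-- The boundary of a square has winding number zero. -/
theorem winding_square (H : C(ℝ × ℝ, UnitAddCircle)) (b r l t d : C(ℝ, UnitAddCircle))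
    (hb : ∀ s, b s = H (s, 0)) (hr : ∀ s, r s = H (1, s)) (hl : ∀ s, l s = H (0, s))
    (ht : ∀ s, t s = H (s, 1)) (hd : ∀ s, d s = H (s, s)) :
    winding b + winding r = winding d ∧ winding l + winding t = winding d := by
  obtain ⟨Q, hQ⟩ := exists_real_lift' H
  rw [winding_eq (q := b) (Q := Q.comp ⟨fun s : ℝ => (s, (0 : ℝ)), by fun_prop⟩) fun s => by simp [hQ, hb],
    winding_eq (q := r) (Q := Q.comp ⟨fun s : ℝ => ((1 : ℝ), s), by fun_prop⟩) fun s => by simp [hQ, hr],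
    winding_eq (q := l) (Q := Q.comp ⟨fun s : ℝ => ((0 : ℝ), s), by fun_prop⟩) fun s => by simp [hQ, hl],
    winding_eq (q := t) (Q := Q.comp ⟨fun s : ℝ => (s, (1 : ℝ)), by fun_prop⟩) fun s => by simp [hQ, ht],
    winding_eq (q := d) (Q := Q.comp ⟨fun s : ℝ => (s, s), by fun_prop⟩) fun s => by simp [hQ, hd]]
  constructor <;> simp

/-- A one-parameter subgroup of the circle with winding number zero is trivial. -/
theorem eq_zero_of_winding_eq_zero {κ : C(ℝ, UnitAddCircle)} (hadd : ∀ s t, κ (s + t) = κ s + κ t)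
    (h0 : winding κ = 0) (t : ℝ) : κ t = 0 := by
  have hκ0 : κ 0 = 0 := by simpa using hadd 0 0
  obtain ⟨Q, hQ0, hQ⟩ := exists_real_lift κ 0 0 (by simp [hκ0])
  -- For fixed `s`, `t ↦ Q (s + t) - Q s` is another lift of `κ` vanishing at `0`, so it equals `Q`.
  -- Being additive and continuous, `Q` is linear.
  have hQadd : ∀ s t, Q (s + t) = Q s + Q t := by
    intro s
    have h1 : Q.comp ⟨fun t : ℝ => s + t, by fun_prop⟩ - ContinuousMap.const ℝ (Q s) = Q :=
      real_lift_unique (q := κ) (a := 0) (by simp [hQ0]) (fun t => by simp [hQ, hadd]) hQ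
    intro t
    have := DFunLike.congr_fun h1 t
    simp at this
    linarith
  have h1 : Q 1 = 0 := by
    have := winding_eq hQ
    rw [h0, hQ0] at this
    linarith
  have h2 := map_real_smul (AddMonoidHom.mk' Q hQadd) Q.continuous t 1
  simp only [AddMonoidHom.mk'_apply, smul_eq_mul, mul_one, h1, mul_zero] at h2
  rw [← hQ, h2]
  simp

/-! ### Winding numbers on homogeneous spaces of nilpotent groups -/

section Nilpotent

variable {X G : Type*} [TopologicalSpace X] [Group G] [TopologicalSpace G] [IsTopologicalGroup G]

/-- The path `t ↦ γ c(t) γ⁻¹ c(t)⁻¹`. -/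
def commPath (γ : G) (c : C(ℝ, G)) : C(ℝ, G) :=
  ContinuousMap.const ℝ γ * c * ContinuousMap.const ℝ γ⁻¹ * c⁻¹

/-- Paths in `G` from `1` whose image under `E` is a loop. -/
def IsLoopLift (E : C(G, X)) (c : C(ℝ, G)) : Prop := c 0 = 1 ∧ E (c 1) = E 1

variable {E : C(G, X)} (hE : ∀ z y y', E y = E y' → E (z * y) = E (z * y'))
include hE

/-- By `hE`, left multiplication on `G` descends along `E`. In the square `(s, t) ↦ E (c s * c' t)`
the left edge is `c'`, the diagonal is the product path, and the top edge is `c` because `c' 1` may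
be dropped under `E`. -/
theorem winding_mul {c c' : C(ℝ, G)} (hc : IsLoopLift E c) (hc' : IsLoopLift E c')
    (f : C(X, UnitAddCircle)) : winding (f.comp (E.comp (c * c')))
      = winding (f.comp (E.comp c)) + winding (f.comp (E.comp c')) := by
  have h := (winding_square (f.comp (E.comp ⟨fun st : ℝ × ℝ => c st.1 * c' st.2, by fun_prop⟩))
    (f.comp (E.comp ⟨fun s : ℝ => c s * c' 0, by fun_prop⟩))
    (f.comp (E.comp ⟨fun s : ℝ => c 1 * c' s, by fun_prop⟩))
    (f.comp (E.comp c')) (f.comp (E.comp c)) (f.comp (E.comp (c * c')))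
    (fun s => rfl) (fun s => rfl) (fun s => by simp [hc.1]) (fun s => ?_) fun s => rfl).2
  · rw [← h, add_comm]
  · have := hE (c s) _ _ hc'.2
    simp only [mul_one] at this
    simp [this]

theorem winding_inv {c : C(ℝ, G)} (hc : IsLoopLift E c) (hc' : IsLoopLift E c⁻¹)
    (f : C(X, UnitAddCircle)) : winding (f.comp (E.comp c⁻¹)) = -winding (f.comp (E.comp c)) := by
  have h := winding_mul hE hc hc' f
  rw [mul_inv_cancel] at h
  have h1 : f.comp (E.comp (1 : C(ℝ, G))) = ContinuousMap.const ℝ (f (E 1)) := rfl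
  rw [h1, winding_const] at h
  linarith

theorem IsLoopLift.inv {c : C(ℝ, G)} (hc : IsLoopLift E c) : IsLoopLift E c⁻¹ := by
  refine ⟨by simp [hc.1], ?_⟩
  have := hE (c 1)⁻¹ _ _ hc.2
  simpa using this.symm

theorem IsLoopLift.commutator {c : C(ℝ, G)} (hc : IsLoopLift E c) {γ : G} (hγ : E γ = E 1) :
    IsLoopLift E (ContinuousMap.const ℝ γ * c * ContinuousMap.const ℝ γ⁻¹) ∧
    IsLoopLift E (commPath γ c) := by
  have h1 : E γ⁻¹ = E 1 := by simpa using (hE γ⁻¹ _ _ hγ).symm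
  have h2 : E (c 1)⁻¹ = E 1 := by simpa using (hc.inv hE).2
  have h3 : E (γ * c 1 * γ⁻¹) = E 1 := by
    rw [hE _ _ _ h1, mul_one, hE _ _ _ hc.2, mul_one, hγ]
  refine ⟨⟨by simp [hc.1], by simpa using h3⟩, by simp [commPath, hc.1], ?_⟩
  have h4 : E (γ * c 1 * γ⁻¹ * (c 1)⁻¹) = E 1 := by rw [hE _ _ _ h2, mul_one, h3]
  simpa [commPath] using h4

/-- Under `E`, `s * c` agrees with `e 1 * (γ * c * γ⁻¹)`, since `γ⁻¹` on the right is invisible.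
Sliding `e 1` back to `1` along `e` is a homotopy of loops, so differencing yields the winding of `γ
* c * γ⁻¹` minus that of `c`, that is, of the commutator. -/
theorem winding_diffOp {S : X ≃ₜ X} {s γ : G} (hS : ∀ y, S (E y) = E (s * y)) {e : C(ℝ, G)}
    (he0 : e 0 = 1) (he1 : e 1 * γ = s) (hγ : E γ = E 1) {c : C(ℝ, G)} (hc : IsLoopLift E c)
    (f : C(X, UnitAddCircle)) :
    winding ((diffOp S f).comp (E.comp c))
      = winding (f.comp (E.comp (commPath γ c))) := by
  obtain ⟨hc1, hc2⟩ := hc.commutator hE hγ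
  have h1 : E γ⁻¹ = E 1 := by simpa using (hE γ⁻¹ _ _ hγ).symm
  set c' : C(ℝ, G) := ContinuousMap.const ℝ γ * c * ContinuousMap.const ℝ γ⁻¹ with hc'
  have e1 : (diffOp S f).comp (E.comp c)
      = f.comp (E.comp (ContinuousMap.const ℝ (e 1) * c')) - f.comp (E.comp c) := by
    ext t
    have : E (e 1 * (γ * c t * γ⁻¹)) = E (s * c t) := by
      rw [← mul_assoc, hE _ _ _ h1, mul_one, ← mul_assoc, he1]
    simp [diffOp_apply, hS, hc', this]
  have e2 : winding (f.comp (E.comp (ContinuousMap.const ℝ (e 1) * c')))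
      = winding (f.comp (E.comp c')) := by
    -- Bottom and top edge of this square both give the loop of `e`, so the left and right edges
    -- wind equally.
    obtain ⟨h3, h4⟩ := winding_square
      (f.comp (E.comp ⟨fun st : ℝ × ℝ => e st.1 * c' st.2, by fun_prop⟩))
      (f.comp (E.comp e)) (f.comp (E.comp (ContinuousMap.const ℝ (e 1) * c')))
      (f.comp (E.comp c')) (f.comp (E.comp e))
      (f.comp (E.comp ⟨fun s : ℝ => e s * c' s, by fun_prop⟩))
      (fun s => by simp [hc1.1]) (fun s => rfl) (fun s => by simp [he0]) (fun s => by
        have := hE (e s) _ _ hc1.2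
        rw [mul_one] at this
        simp [this]) (fun s => rfl)
    linarith
  have e3 : (commPath γ c) = c' * c⁻¹ := rfl
  rw [e1, winding_sub, e2, e3, winding_mul hE hc1 (hc.inv hE), winding_inv hE hc (hc.inv hE),
    sub_eq_add_neg]

/-- Each difference trades the path for a commutator path one step further down the lower central
series; after `d` steps the path is constant. -/
theorem winding_diffOp_pow_eq_zero {S : X ≃ₜ X} {s γ : G} (hS : ∀ y, S (E y) = E (s * y))
    {e : C(ℝ, G)} (he0 : e 0 = 1) (he1 : e 1 * γ = s) (hγ : E γ = E 1) {d : ℕ}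
    (hnil : (⊤ : Subgroup G).lowerCentralSeries d = ⊥) {c : C(ℝ, G)} (hc : IsLoopLift E c)
    (f : C(X, UnitAddCircle)) : winding (((diffOp S ^ d) f).comp (E.comp c)) = 0 := by
  have key : ∀ j, ∀ f : C(X, UnitAddCircle), ∃ c' : C(ℝ, G), IsLoopLift E c' ∧
      (∀ t, c' t ∈ (⊤ : Subgroup G).lowerCentralSeries j) ∧
      winding (((diffOp S ^ j) f).comp (E.comp c)) = winding (f.comp (E.comp c')) := by
    intro j
    induction j with
    | zero => exact fun f => ⟨c, hc, fun t => by simp, by simp⟩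
    | succ j ih =>
      intro f
      obtain ⟨c', h1, h2, h3⟩ := ih (diffOp S f)
      refine ⟨_, (h1.commutator hE hγ).2, fun t => ?_, ?_⟩
      · rw [Subgroup.lowerCentralSeries_succ, Subgroup.commutator_comm]
        have := Subgroup.commutator_mem_commutator (Subgroup.mem_top γ) (h2 t)
        simpa [commPath, commutatorElement_def] using this
      · rw [diffOp_pow_succ_apply, h3, winding_diffOp hE hS he0 he1 hγ h1]
  obtain ⟨c', h1, h2, h3⟩ := key d f
  have : c' = 1 := by
    ext t
    have := h2 t
    rw [hnil, Subgroup.mem_bot] at this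
    simpa using this
  rw [h3, this]
  exact winding_const (f (E 1))

end Nilpotent

/-! ### Algebraic lemmas -/

/-- Factor `u ^ q - 1 = (u - 1) * W` with `W = 1 + u + ⋯ + u^(q-1)`. Once `(u - 1) ^ (j + 1) = 0`,
`u` acts as `1` on `(u - 1) ^ j`, so `W` acts as `q`, which can be cancelled. This lowers the
exponent from `m` down to `d`. -/
theorem sub_one_pow_eq_zero_of_pow_sub_one_pow {A : Type*} [Ring A] {u : A} {m q d : ℕ}
    (hm : (u - 1) ^ m = 0) (hd : (u ^ q - 1) ^ d = 0) (hq : ∀ x : A, q • x = 0 → x = 0) :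
    (u - 1) ^ d = 0 := by
  set W := ∑ i ∈ Finset.range q, u ^ i with hW
  have hfac : (u ^ q - 1) = (u - 1) * W := (mul_geom_sum u q).symm
  have hcomm : Commute (u - 1) W := by
    refine Commute.sum_right _ _ _ fun i _ => ?_
    exact ((Commute.refl u).sub_left (Commute.one_left u)).pow_right i
  rw [hfac, hcomm.mul_pow] at hd
  have step : ∀ j, d ≤ j → (u - 1) ^ (j + 1) = 0 → (u - 1) ^ j = 0 := by
    intro j hj h0
    have h1 : (u - 1) ^ j * u = (u - 1) ^ j := by
      have : (u - 1) ^ j * (u - 1) = 0 := by rw [← pow_succ, h0]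
      rw [mul_sub, mul_one, sub_eq_zero] at this
      exact this
    have h2 : ∀ i, (u - 1) ^ j * u ^ i = (u - 1) ^ j := by
      intro i
      induction i with
      | zero => simp
      | succ i ih => rw [pow_succ, ← mul_assoc, ih, h1]
    have h3 : (u - 1) ^ j * W = q • (u - 1) ^ j := by
      rw [hW, Finset.mul_sum]; simp [h2]
    have h4 : ∀ i, (u - 1) ^ j * W ^ i = q ^ i • (u - 1) ^ j := by
      intro i
      induction i with
      | zero => simp
      | succ i ih => rw [pow_succ, ← mul_assoc, ih, smul_mul_assoc, h3, smul_smul, pow_succ]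
    have h5 : q ^ d • (u - 1) ^ j = 0 := by
      rw [← h4, ← Nat.sub_add_cancel hj, pow_add, mul_assoc, hd, mul_zero]
    have h6 : ∀ i, q ^ i • (u - 1) ^ j = 0 → (u - 1) ^ j = 0 := by
      intro i
      induction i with
      | zero => simp
      | succ i ih => exact fun h => ih (hq _ (by rw [smul_smul, ← pow_succ']; exact h))
    exact h6 d h5
  have down : ∀ k, (u - 1) ^ (d + k) = 0 → (u - 1) ^ d = 0 := by
    intro k
    induction k with
    | zero => exact id
    | succ k ih => exact fun h => ih (step _ (by omega) h)
  exact down m (by rw [pow_add, hm, mul_zero])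

/-- The difference operator of a permutation of a finite set. -/
def permDiff {F : Type*} (σ : Equiv.Perm F) : AddMonoid.End (F → UnitAddCircle) where
  toFun u := u ∘ σ - u
  map_zero' := by ext; simp
  map_add' u v := by ext s; simp; abel

theorem permDiff_apply {F : Type*} (σ : Equiv.Perm F) (u : F → UnitAddCircle) (s : F) :
    permDiff σ u s = u (σ s) - u s := rfl

theorem exists_nsmul_eq_unitAddCircle {N : ℕ} (hN : 0 < N) (θ : UnitAddCircle) :
    ∃ η : UnitAddCircle, N • η = θ := by
  obtain ⟨t, rfl⟩ := QuotientAddGroup.mk_surjective θ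
  refine ⟨((t / N : ℝ) : UnitAddCircle), ?_⟩
  rw [← AddCircle.coe_nsmul, nsmul_eq_mul, mul_div_cancel₀ _ (by positivity)]

/-- The circle is divisible, so `v` can be averaged over the powers of `σ`: the average is
invariant, and the deviation from it is a coboundary by telescoping. -/
theorem exists_permDiff_add_invariant {F : Type*} [Finite F] (σ : Equiv.Perm F)
    (v : F → UnitAddCircle) : ∃ u c : F → UnitAddCircle, permDiff σ c = 0 ∧ v = permDiff σ u + c := by
  set N := orderOf σ
  have hN : 0 < N := orderOf_pos σ
  choose w hw using fun s => exists_nsmul_eq_unitAddCircle hN (v s)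
  have hstep : ∀ (l : ℕ) (s : F), (σ ^ l) (σ s) = (σ ^ (l + 1)) s := fun l s => by
    rw [pow_succ, Equiv.Perm.mul_apply]
  refine ⟨fun s => -∑ l ∈ Finset.range N, ∑ i ∈ Finset.range l, w ((σ ^ i) s),
    fun s => ∑ l ∈ Finset.range N, w ((σ ^ l) s), ?_, ?_⟩
  · ext s
    simp only [permDiff_apply, hstep, Pi.zero_apply]
    rw [← Finset.sum_sub_distrib, Finset.sum_range_sub (fun l => w ((σ ^ l) s)),
      pow_orderOf_eq_one, pow_zero, sub_self]
  · ext s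
    simp only [Pi.add_apply, permDiff_apply, hstep]
    rw [neg_sub_neg, ← Finset.sum_sub_distrib]
    have : ∀ l, ∑ i ∈ Finset.range l, w ((σ ^ i) s) - ∑ i ∈ Finset.range l, w ((σ ^ (i + 1)) s)
        = w s - w ((σ ^ l) s) := by
      intro l
      rw [← Finset.sum_sub_distrib, Finset.sum_range_sub' (fun l => w ((σ ^ l) s))]
      simp
    rw [Finset.sum_congr rfl fun l _ => this l, Finset.sum_sub_distrib, sub_add_cancel]
    simp [hw]

/-- Modulo invariant functions, which `permDiff σ` kills, every function is itself a difference; so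
further differencing does not shrink the image. -/
theorem exists_permDiff_pow_succ_eq {F : Type*} [Finite F] (σ : Equiv.Perm F) (d : ℕ)
    (v : F → UnitAddCircle) : ∃ u, (permDiff σ ^ (d + 1)) u = permDiff σ v := by
  induction d with
  | zero => exact ⟨v, by simp⟩
  | succ d ih =>
    obtain ⟨u, hu⟩ := ih
    obtain ⟨u', c, hc, rfl⟩ := exists_permDiff_add_invariant σ u
    refine ⟨u', ?_⟩
    rw [← hu, map_add, pow_succ (permDiff σ) (d + 1)]
    have : (permDiff σ ^ (d + 1)) c = 0 := by
      rw [pow_succ]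
      change (permDiff σ ^ d) (permDiff σ c) = 0
      rw [hc, map_zero]
    rw [this, add_zero]
    rfl

theorem exists_permDiff_sq_eq_zero_separating {F : Type*} [Finite F] (σ : Equiv.Perm F) {s s' : F}
    (hs : s ≠ s') : ∃ u : F → UnitAddCircle, permDiff σ (permDiff σ u) = 0 ∧ u s ≠ u s' := by
  classical
  set ℓ := Function.minimalPeriod σ s with hℓ
  have hℓ0 : 0 < ℓ := by
    refine Function.minimalPeriod_pos_of_mem_periodicPts ?_
    exact ⟨orderOf σ, orderOf_pos σ, by
      rw [Function.IsPeriodicPt, Function.IsFixedPt, Equiv.Perm.iterate_eq_pow,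
        pow_orderOf_eq_one]; rfl⟩
  have : NeZero (2 * ℓ) := ⟨by positivity⟩
  have hmod : ∀ i j : ℕ, σ^[i] s = σ^[j] s → (i : ℕ) ≡ j [MOD ℓ] := by
    intro i j hij
    rw [← Function.iterate_mod_minimalPeriod_eq, ← Function.iterate_mod_minimalPeriod_eq (n := j)]
      at hij
    exact Function.iterate_injOn_Iio_minimalPeriod (Nat.mod_lt _ hℓ0) (Nat.mod_lt _ hℓ0) hij
  have hcast : ∀ i j : ℕ, σ^[i] s = σ^[j] s → ((2 * i : ℕ) : ZMod (2 * ℓ)) = ((2 * j : ℕ) : ZMod (2 * ℓ)) :=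
    fun i j hij => (ZMod.natCast_eq_natCast_iff _ _ _).mpr ((hmod i j hij).mul_left' 2)
  -- Even values `2j` along the orbit of `s` and the odd value `1` off it: the first difference is
  -- then constant on the orbit and zero elsewhere. Doubling the modulus keeps `1` away from `0` and
  -- from the even values even when `ℓ = 1`.
  set k : F → ZMod (2 * ℓ) := fun t => if ht : ∃ j : ℕ, σ^[j] s = t then
    ((2 * ht.choose : ℕ) : ZMod (2 * ℓ)) else 1 with hk
  have hk1 : ∀ j : ℕ, k (σ^[j] s) = ((2 * j : ℕ) : ZMod (2 * ℓ)) := by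
    intro j
    have hex : ∃ i : ℕ, σ^[i] s = σ^[j] s := ⟨j, rfl⟩
    simp only [hk]
    rw [dif_pos hex]
    exact hcast _ _ hex.choose_spec
  have hk2 : ∀ t, (¬ ∃ j : ℕ, σ^[j] s = t) → k t = 1 := fun t ht => dif_neg ht
  have hout : ∀ t, (¬ ∃ j : ℕ, σ^[j] s = t) → ¬ ∃ j : ℕ, σ^[j] s = σ t := by
    rintro t ht ⟨j, hj⟩
    refine ht ⟨j + ℓ - 1, σ.injective ?_⟩
    rw [← hj, ← Function.iterate_succ_apply' σ, show (j + ℓ - 1).succ = j + ℓ by omega,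
      Function.iterate_add_apply, Function.iterate_minimalPeriod]
  refine ⟨fun t => ZMod.toAddCircle (k t), ?_, ?_⟩
  · have h1 : ∀ t, k (σ t) - k t = if ∃ j : ℕ, σ^[j] s = t then 2 else 0 := by
      intro t
      split_ifs with ht
      · obtain ⟨j, rfl⟩ := ht
        rw [← Function.iterate_succ_apply' σ, hk1, hk1]
        push_cast; ring
      · rw [hk2 _ ht, hk2 _ (hout t ht), sub_self]
    ext t
    simp only [permDiff_apply, ← map_sub, h1, Pi.zero_apply]
    by_cases ht : ∃ j : ℕ, σ^[j] s = t
    · have ht' : ∃ j : ℕ, σ^[j] s = σ t := by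
        obtain ⟨j, rfl⟩ := ht
        exact ⟨j + 1, Function.iterate_succ_apply' σ j s⟩
      rw [if_pos ht, if_pos ht', sub_self, map_zero]
    · rw [if_neg ht, if_neg (hout t ht), sub_self, map_zero]
  · intro heq
    have h2 := ZMod.toAddCircle_injective _ heq
    have h3 : k s = 0 := by simpa using hk1 0
    rw [h3] at h2
    by_cases ht : ∃ j : ℕ, σ^[j] s = s'
    · obtain ⟨j, rfl⟩ := ht
      rw [hk1, eq_comm, ZMod.natCast_eq_zero_iff] at h2
      have h4 : ℓ ∣ j := (Nat.mul_dvd_mul_iff_left two_pos).mp h2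
      exact hs ((Function.isPeriodicPt_iff_minimalPeriod_dvd.mpr h4).eq).symm
    · rw [hk2 _ ht] at h2
      have h5 : ((1 : ℕ) : ZMod (2 * ℓ)) = 0 := by simpa using h2.symm
      rw [ZMod.natCast_eq_zero_iff] at h5
      have := Nat.le_of_dvd one_pos h5
      omega

/-! ### Unipotent affine transformations of a compact abelian Lie group -/

section Affine

variable {X : Type*} [AddCommGroup X] [TopologicalSpace X] {k : ℕ} {F : Type*} [AddCommGroup F]
  [TopologicalSpace F]

/-- The inclusion of the torus. -/
def torusIncl (ψ : X ≃ₜ+ (Fin k → UnitAddCircle) × F) : (Fin k → UnitAddCircle) →+ X :=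
  (ψ.symm : (Fin k → UnitAddCircle) × F →+ X).comp (AddMonoidHom.inl _ _)

/-- The inclusion of the finite group. -/
def finIncl (ψ : X ≃ₜ+ (Fin k → UnitAddCircle) × F) : F →+ X :=
  (ψ.symm : (Fin k → UnitAddCircle) × F →+ X).comp (AddMonoidHom.inr _ _)

/-- The projection to the finite group. -/
def finProj (ψ : X ≃ₜ+ (Fin k → UnitAddCircle) × F) : X →+ F :=
  (AddMonoidHom.snd _ _).comp (ψ : X →+ (Fin k → UnitAddCircle) × F)

/-- The coordinates on the torus. -/
def torusCoord (ψ : X ≃ₜ+ (Fin k → UnitAddCircle) × F) (i : Fin k) : C(X, UnitAddCircle) :=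
  ⟨fun x => (ψ x).1 i, by fun_prop⟩

/-- An automorphism as an element of the endomorphism ring. -/
def linPart (U : X ≃ₜ+ X) : AddMonoid.End X := (U : X →+ X)

variable (ψ : X ≃ₜ+ (Fin k → UnitAddCircle) × F)

theorem continuous_torusIncl : Continuous (torusIncl ψ) :=
  ψ.symm.continuous.comp (Continuous.prodMk_left 0)

theorem continuous_finProj : Continuous (finProj ψ) :=
  continuous_snd.comp ψ.continuous

theorem finProj_finIncl (s : F) : finProj ψ (finIncl ψ s) = s := by
  change (ψ (ψ.symm (0, s))).2 = s
  simp

theorem torusCoord_torusIncl (τ : Fin k → UnitAddCircle) (i : Fin k) :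
    torusCoord ψ i (torusIncl ψ τ) = τ i := by
  change (ψ (ψ.symm (τ, 0))).1 i = τ i
  simp

theorem torusCoord_add (i : Fin k) (x y : X) :
    torusCoord ψ i (x + y) = torusCoord ψ i x + torusCoord ψ i y := by
  simp [torusCoord]

theorem torusIncl_add_finIncl (x : X) :
    torusIncl ψ (ψ x).1 + finIncl ψ (finProj ψ x) = x := by
  apply ψ.injective
  rw [map_add]
  change ψ (ψ.symm _) + ψ (ψ.symm _) = ψ x
  simp only [ContinuousAddEquiv.apply_symm_apply]
  change ((ψ x).1, (0 : F)) + ((0 : Fin k → UnitAddCircle), (ψ x).2) = ψ x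
  ext <;> simp

theorem eq_torusIncl_of_finProj_eq_zero {x : X} (hx : finProj ψ x = 0) :
    x = torusIncl ψ (ψ x).1 := by
  conv_lhs => rw [← torusIncl_add_finIncl ψ x, hx, map_zero, add_zero]

theorem eq_of_torusCoord_eq {x y : X} (h1 : finProj ψ x = finProj ψ y)
    (h2 : ∀ i, torusCoord ψ i x = torusCoord ψ i y) : x = y :=
  ψ.injective (Prod.ext (funext h2) h1)

theorem finProj_apply_torusIncl [DiscreteTopology F] (U : X ≃ₜ+ X) (τ : Fin k → UnitAddCircle) :
    finProj ψ (U (torusIncl ψ τ)) = 0 := by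
  have hc : Continuous fun τ => finProj ψ (U (torusIncl ψ τ)) :=
    (continuous_finProj ψ).comp (U.continuous.comp (continuous_torusIncl ψ))
  have := PreconnectedSpace.constant inferInstance hc (x := τ) (y := 0)
  simpa using this

theorem torusIncl_mem_connectedComponent (τ : Fin k → UnitAddCircle) :
    torusIncl ψ τ ∈ connectedComponent (0 : X) := by
  have h1 : IsPreconnected (Set.range (torusIncl ψ)) :=
    isPreconnected_range (continuous_torusIncl ψ)
  exact h1.subset_connectedComponent ⟨0, map_zero _⟩ ⟨τ, rfl⟩

theorem exists_finPerm [DiscreteTopology F] [Finite F] {T : X ≃ₜ X} {a : X} {U : X ≃ₜ+ X}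
    (hT : ∀ x, T x = a + U x) : ∃ σ : Equiv.Perm F, ∀ x, finProj ψ (T x) = σ (finProj ψ x) := by
  have h1 : ∀ x, finProj ψ (T x) = finProj ψ a + finProj ψ (U (finIncl ψ (finProj ψ x))) := by
    intro x
    have h2 : U x = U (torusIncl ψ (ψ x).1) + U (finIncl ψ (finProj ψ x)) := by
      rw [← map_add, torusIncl_add_finIncl]
    rw [hT, map_add, h2, map_add, finProj_apply_torusIncl, zero_add]
  have hsurj : Function.Surjective fun s => finProj ψ a + finProj ψ (U (finIncl ψ s)) := by
    intro s
    obtain ⟨x, hx⟩ := T.surjective (finIncl ψ s)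
    exact ⟨finProj ψ x, by dsimp only; rw [← h1, hx, finProj_finIncl]⟩
  exact ⟨Equiv.ofBijective _ ⟨Finite.injective_iff_surjective.mpr hsurj, hsurj⟩, h1⟩

theorem finProj_pow {T : X ≃ₜ X} {σ : Equiv.Perm F}
    (hσ : ∀ x, finProj ψ (T x) = σ (finProj ψ x)) (n : ℕ) (x : X) :
    finProj ψ ((T ^ n) x) = (σ ^ n) (finProj ψ x) := by
  induction n with
  | zero => rfl
  | succ n ih => rw [pow_succ', pow_succ', Homeomorph.mul_apply, hσ, ih]; rfl

theorem affine_pow {T : X ≃ₜ X} {a : X} {U : X ≃ₜ+ X} (hT : ∀ x, T x = a + U x) (n : ℕ) (x : X) :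
    (T ^ n) x = (T ^ n) 0 + (linPart U ^ n) x := by
  induction n with
  | zero => simp
  | succ n ih =>
    rw [pow_succ', Homeomorph.mul_apply, Homeomorph.mul_apply, ih, hT, hT, map_add, add_assoc,
      pow_succ' (linPart U)]
    rfl

/-- Differencing an additive `χ` applies `V` to the argument and adds a constant; later differences
cancel the earlier constants. -/
theorem diffOp_pow_additive {S : X ≃ₜ X} {V : AddMonoid.End X} (hS : ∀ x, S x - x = S 0 + V x)
    {χ : C(X, UnitAddCircle)} (hχ : ∀ x y, χ (x + y) = χ x + χ y) (j : ℕ) :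
    ∃ θ, ∀ x, (diffOp S ^ j) χ x = θ + χ ((V ^ j) x) := by
  induction j with
  | zero => exact ⟨0, fun x => by simp⟩
  | succ j ih =>
    obtain ⟨θ, hθ⟩ := ih
    refine ⟨χ ((V ^ j) (S 0)), fun x => ?_⟩
    have h1 : (diffOp S ^ (j + 1)) χ x = (diffOp S ^ j) χ (S x) - (diffOp S ^ j) χ x := by
      rw [pow_succ']; rfl
    have h2 : S x = x + (S 0 + V x) := by rw [← hS x]; abel
    rw [h1, hθ, hθ, h2, map_add, map_add (V ^ j), hχ, hχ, pow_succ]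
    change _ = _ + χ ((V ^ j) (V x))
    abel

theorem pow_torusIncl {V : AddMonoid.End X} {v : AddMonoid.End (Fin k → UnitAddCircle)}
    (h : ∀ τ, V (torusIncl ψ τ) = torusIncl ψ (v τ)) (j : ℕ) (τ : Fin k → UnitAddCircle) :
    (V ^ j) (torusIncl ψ τ) = torusIncl ψ ((v ^ j) τ) := by
  induction j with
  | zero => rfl
  | succ j ih =>
    rw [pow_succ', pow_succ']
    change V ((V ^ j) _) = torusIncl ψ (v ((v ^ j) τ))
    rw [ih, h]

theorem sub_one_torusIncl {V : AddMonoid.End X} {v : AddMonoid.End (Fin k → UnitAddCircle)}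
    (h : ∀ τ, V (torusIncl ψ τ) = torusIncl ψ (v τ)) (τ : Fin k → UnitAddCircle) :
    (V - 1) (torusIncl ψ τ) = torusIncl ψ ((v - 1) τ) := by
  change V _ - torusIncl ψ τ = torusIncl ψ (v τ - τ)
  rw [h, map_sub]

/-- The torus is divisible, so its endomorphism ring has no torsion. -/
theorem end_torus_nsmul_eq_zero {q : ℕ} (hq : 0 < q) (φ : AddMonoid.End (Fin k → UnitAddCircle))
    (h : q • φ = 0) : φ = 0 := by
  ext1 τ
  choose η hη using fun i => exists_nsmul_eq_unitAddCircle hq (τ i)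
  have h1 : τ = q • η := by ext i; simp [hη]
  rw [h1, map_nsmul]
  exact DFunLike.congr_fun h η

/-- The linear part of a unipotent affine transformation that is conjugate to a `d`-step nilsystem
satisfies `(U - 1)^d = 0` on the torus. -/
theorem sub_one_pow_torusIncl_eq_zero [IsTopologicalAddGroup X] [DiscreteTopology F] [Finite F]
    {T : X ≃ₜ X} {a : X} {U : X ≃ₜ+ X} (hT : ∀ x, T x = a + U x) {m : ℕ}
    (hm : ∀ x ∈ connectedComponent (0 : X), (fun y => U y - y)^[m] x = 0) {d : ℕ}
    (hnil : IsNilsystemOfStep d T) (τ : Fin k → UnitAddCircle) :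
    ((linPart U - 1) ^ d) (torusIncl ψ τ) = 0 := by
  obtain ⟨σ, hσ⟩ := exists_finPerm ψ hT
  set UA : AddMonoid.End X := linPart U with hUA
  set u : AddMonoid.End (Fin k → UnitAddCircle) :=
    ((AddMonoidHom.fst _ _).comp (ψ : X →+ (Fin k → UnitAddCircle) × F)).comp
      (UA.comp (torusIncl ψ)) with hu
  have hUu : ∀ τ, UA (torusIncl ψ τ) = torusIncl ψ (u τ) := fun τ =>
    eq_torusIncl_of_finProj_eq_zero ψ (finProj_apply_torusIncl ψ U τ)
  have inj : ∀ τ, torusIncl ψ τ = 0 → τ = 0 := by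
    intro τ h
    ext i
    have := torusCoord_torusIncl ψ τ i
    rw [h] at this
    rw [← this]
    simp [torusCoord]
  have hunip : (u - 1) ^ m = 0 := by
    ext1 τ
    apply inj
    rw [← pow_torusIncl ψ (sub_one_torusIncl ψ hUu) m τ]
    have h1 := hm _ (torusIncl_mem_connectedComponent ψ τ)
    rw [← h1, AddMonoid.End.coe_pow]
    rfl
  -- `T^q` preserves every fibre of `finProj`, so `S 0` lies in the torus and can be joined to `0`
  -- by a path.
  set q := orderOf σ
  have hq : 0 < q := orderOf_pos σ
  set S : X ≃ₜ X := T ^ q with hSdef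
  have hS0 : finProj ψ (S 0) = 0 := by
    rw [hSdef, finProj_pow ψ hσ, pow_orderOf_eq_one, map_zero]; rfl
  have hSV : ∀ x, S x - x = S 0 + (UA ^ q - 1) x := by
    intro x
    rw [hSdef, affine_pow hT q x]
    change _ = _ + ((UA ^ q) x - x)
    abel
  have hpow : (u ^ q - 1) ^ d = 0 := by
    obtain ⟨G, _, _, _, _, n, _, _, Γ, g, Φ, hG, hΓ, -, hconj⟩ := hnil
    have : IsTopologicalGroup G := topologicalGroup_of_lieGroup (𝓡 n) ∞
    -- Right translation by a representative `b` of `Φ 0` normalises the covering to `E 1 = 0`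
    -- without disturbing left multiplication.
    obtain ⟨b, hb⟩ := QuotientGroup.mk_surjective (Φ 0)
    have hcov : IsCoveringMap (Φ.symm ∘ (QuotientGroup.mk (s := Γ)) ∘ (Homeomorph.mulRight b)) :=
      ((Subgroup.isQuotientCoveringMap Γ ⟨hΓ⟩).isCoveringMap.comp_homeomorph _).homeomorph_comp _
    set E : C(G, X) := ⟨_, hcov.continuous⟩ with hEdef
    have hEa : ∀ y, E y = Φ.symm ((y * b : G) : G ⧸ Γ) := fun y => rfl
    have hE : ∀ z y y', E y = E y' → E (z * y) = E (z * y') := by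
      intro z y y' h
      rw [hEa, hEa] at h ⊢
      have h1 := Φ.symm.injective h
      rw [QuotientGroup.eq] at h1
      congr 1
      rw [QuotientGroup.eq]
      convert h1 using 1
      group
    have hE1 : E 1 = 0 := by rw [hEa, one_mul, hb, Φ.symm_apply_apply]
    have hTE : ∀ y, T (E y) = E (g * y) := by
      intro y
      apply Φ.injective
      rw [hconj, hEa, hEa, Φ.apply_symm_apply, Φ.apply_symm_apply, mul_assoc]
      rfl
    have hSE : ∀ (i : ℕ) (y), (T ^ i) (E y) = E (g ^ i * y) := by
      intro i
      induction i with
      | zero => intro y; simp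
      | succ i ih => intro y; rw [pow_succ', Homeomorph.mul_apply, ih, hTE, ← mul_assoc, ← pow_succ']
    have hlift : ∀ ℓ : C(ℝ, X), ℓ 0 = 0 → ∃ c : C(ℝ, G), c 0 = 1 ∧ ∀ t, E (c t) = ℓ t := by
      intro ℓ hℓ
      obtain ⟨c, ⟨h1, h2⟩, -⟩ := hcov.existsUnique_continuousMap_lifts ℓ 0 1 (hE1.trans hℓ.symm)
      exact ⟨c, h1, fun t => congrFun h2 t⟩
    -- `e` lifts the straight path from `0` to `S 0`. Its endpoint and `g ^ q` lie over the same
    -- point, so they differ by an element `γ` with `E γ = E 1`.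
    obtain ⟨e, he0, heE⟩ : ∃ e : C(ℝ, G), e 0 = 1 ∧ E (e 1) = S 0 := by
      choose t ht using fun i => QuotientAddGroup.mk_surjective ((ψ (S 0)).1 i)
      obtain ⟨e, h1, h2⟩ := hlift ⟨fun s => torusIncl ψ fun i => ((s * t i : ℝ) : UnitAddCircle),
        (continuous_torusIncl ψ).comp (continuous_pi fun i =>
          (AddCircle.continuous_mk' 1).comp (by fun_prop))⟩ (by
            change torusIncl ψ (fun i => ((0 * t i : ℝ) : UnitAddCircle)) = 0
            simp only [zero_mul, AddCircle.coe_zero]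
            exact map_zero _)
      refine ⟨e, h1, ?_⟩
      rw [h2, eq_torusIncl_of_finProj_eq_zero ψ hS0]
      change torusIncl ψ (fun i => ((1 * t i : ℝ) : UnitAddCircle)) = _
      congr 1
      ext i
      rw [one_mul]
      exact ht i
    have hγ : E ((e 1)⁻¹ * g ^ q) = E 1 := by
      have h1 := hSE q 1
      rw [mul_one, hE1] at h1
      have h2 : E (g ^ q) = E (e 1) := by rw [heE, ← h1]
      rw [hE _ _ _ h2, inv_mul_cancel]
    have hcoord : ∀ (j i : Fin k) (t : ℝ),
        ((u ^ q - 1) ^ d) (Pi.single j (t : UnitAddCircle)) i = 0 := by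
      intro j i t
      set ℓ : C(ℝ, X) := ⟨fun t : ℝ => torusIncl ψ (Pi.single j (t : UnitAddCircle)),
        (continuous_torusIncl ψ).comp ((continuous_single j).comp (AddCircle.continuous_mk' 1))⟩
        with hℓdef
      have hℓ : ∀ t, ℓ t = torusIncl ψ (Pi.single j (t : UnitAddCircle)) := fun t => rfl
      obtain ⟨c, hc0, hcE⟩ := hlift ℓ (by rw [hℓ]; simp)
      have hc : IsLoopLift E c := by
        refine ⟨hc0, ?_⟩
        have h1 : ((1 : ℝ) : UnitAddCircle) = 0 := by exact_mod_cast intCast_unitAddCircle 1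
        rw [hcE, hℓ, h1, Pi.single_zero, map_zero, hE1]
      have hw := winding_diffOp_pow_eq_zero hE (hSE q) he0 (mul_inv_cancel_left (e 1) (g ^ q)) hγ hG hc
        (torusCoord ψ i)
      obtain ⟨θ, hθ⟩ := diffOp_pow_additive hSV (torusCoord_add ψ i) d
      -- Along the `j`-th coordinate loop, the `d`-th difference of a coordinate is a constant plus
      -- a one-parameter subgroup. Its winding number vanishes by nilpotency, so the subgroup is
      -- trivial.
      set κ : C(ℝ, UnitAddCircle) := ((diffOp S ^ d) (torusCoord ψ i)).comp (E.comp c)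
        - ContinuousMap.const ℝ θ with hκ
      have hκa : ∀ t, κ t = ((u ^ q - 1) ^ d) (Pi.single j (t : UnitAddCircle)) i := by
        intro t
        simp only [hκ, ContinuousMap.sub_apply, ContinuousMap.comp_apply, ContinuousMap.const_apply,
          hcE, hℓ, hθ]
        rw [pow_torusIncl ψ (sub_one_torusIncl ψ (pow_torusIncl ψ hUu q)), torusCoord_torusIncl,
          add_sub_cancel_left]
      rw [← hκa]
      refine eq_zero_of_winding_eq_zero (fun s t => ?_) ?_ t
      · rw [hκa, hκa, hκa, AddCircle.coe_add, Pi.single_add, map_add]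
        rfl
      · rw [hκ, winding_sub, hw, winding_const, sub_zero]
    ext1 τ
    ext i
    rw [← Finset.univ_sum_single τ, map_sum, Finset.sum_apply]
    refine Finset.sum_eq_zero fun j _ => ?_
    obtain ⟨t, ht⟩ := QuotientAddGroup.mk_surjective (τ j)
    rw [← ht]
    exact hcoord j i t
  have hfin := sub_one_pow_eq_zero_of_pow_sub_one_pow hunip hpow
    (fun φ h => end_torus_nsmul_eq_zero hq φ h)
  rw [pow_torusIncl ψ (sub_one_torusIncl ψ hUu), hfin]
  exact map_zero _

end Affine

/-- On a `d`-step Weyl system the phase polynomials of degree at most `d` separate points. -/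
theorem exists_mem_polyPhases_separating {X : Type*} [AddCommGroup X] [TopologicalSpace X]
    [IsTopologicalAddGroup X] {T : X ≃ₜ X} (hX : IsTorusTimesFinite X) (hT : IsUnipotentAffine T)
    {d : ℕ} (hd : 1 ≤ d) (hnil : IsNilsystemOfStep d T) {x y : X} (hxy : x ≠ y) :
    ∃ f ∈ polyPhases T d, f x ≠ f y := by
  obtain ⟨k, F, _, _, _, _, ⟨ψ⟩⟩ := hX
  obtain ⟨a, U, hTU, m, hm⟩ := hT
  obtain ⟨σ, hσ⟩ := exists_finPerm ψ hTU
  set lift : (F → UnitAddCircle) → C(X, UnitAddCircle) := fun u =>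
    ⟨fun x => u (finProj ψ x), continuous_of_discreteTopology.comp (continuous_finProj ψ)⟩ with hlift
  have hliftD : ∀ (i : ℕ) u, (diffOp T ^ i) (lift u) = lift ((permDiff σ ^ i) u) := by
    intro i
    induction i with
    | zero => intro u; rfl
    | succ i ih =>
      intro u
      have h1 : diffOp T (lift u) = lift (permDiff σ u) := by
        ext x
        simp [diffOp_apply, hlift, permDiff_apply, hσ]
      rw [diffOp_pow_succ_apply, h1, ih, pow_succ]
      rfl
  by_cases hfin : finProj ψ x = finProj ψ y
  · obtain ⟨i, hi⟩ : ∃ i, torusCoord ψ i x ≠ torusCoord ψ i y := by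
      by_contra! hcon
      exact hxy (eq_of_torusCoord_eq ψ hfin hcon)
    have hTV : ∀ x, T x - x = T 0 + (linPart U - 1) x := by
      intro x
      rw [hTU, hTU, map_zero, add_zero, add_sub_assoc]
      rfl
    obtain ⟨θ, hθ⟩ := diffOp_pow_additive hTV (torusCoord_add ψ i) d
    set v : F → UnitAddCircle := fun s =>
      θ + torusCoord ψ i (((linPart U - 1) ^ d) (finIncl ψ s)) with hv
    -- The torus part is killed by `(U - 1)^d`, so the `d`-th difference depends on the finite
    -- component only. It need not be invariant; subtracting a suitable `lift u` corrects this
    -- without affecting separation within a component.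
    have hDv : (diffOp T ^ d) (torusCoord ψ i) = lift v := by
      ext x
      rw [hθ]
      conv_lhs => rw [← torusIncl_add_finIncl ψ x, map_add,
        sub_one_pow_torusIncl_eq_zero ψ hTU hm hnil, zero_add]
      rfl
    obtain ⟨u, hu⟩ := exists_permDiff_pow_succ_eq σ d v
    refine ⟨torusCoord ψ i - lift u, ?_, ?_⟩
    · rw [mem_polyPhases, map_sub, hliftD, hu, add_comm, diffOp_pow_add_apply, hDv, pow_one]
      have := hliftD 1 v
      rw [pow_one, pow_one] at this
      rw [this, sub_self]
    · intro h
      apply hi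
      simp only [ContinuousMap.sub_apply] at h
      have : lift u x = lift u y := by simp [hlift, hfin]
      rw [this] at h
      exact sub_left_inj.mp h
  · obtain ⟨u, hu1, hu2⟩ := exists_permDiff_sq_eq_zero_separating σ hfin
    refine ⟨lift u, ?_, hu2⟩
    obtain ⟨e, rfl⟩ := Nat.exists_eq_add_of_le' hd
    rw [mem_polyPhases, hliftD, pow_add, pow_succ, pow_one]
    have : (permDiff σ ^ e * permDiff σ * permDiff σ) u = 0 := by
      change (permDiff σ ^ e) (permDiff σ (permDiff σ u)) = 0
      rw [hu1, map_zero]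
    rw [this]
    rfl

/-! ### Oscillation of Riemann integrable functions -/

/-- The interval `(k/K, (k+1)/K]` as a box. -/
noncomputable def equiBox (K : ℕ) [NeZero K] : ℕ ↪ BoxIntegral.Box (Fin 1) :=
  ⟨fun k => BoxIntegral.unitPartition.box K fun _ : Fin 1 => (k : ℤ), fun a b h => by
    have := congrFun (BoxIntegral.unitPartition.box_injective K h) 0
    exact_mod_cast this⟩

theorem equiBox_apply (K : ℕ) [NeZero K] (k : ℕ) :
    equiBox K k = BoxIntegral.unitPartition.box K fun _ : Fin 1 => (k : ℤ) := rfl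

open BoxIntegral in
/-- The partition of the unit interval into `K` equal pieces, with tags `s k`. -/
noncomputable def equiPartition (K : ℕ) [NeZero K] (s : ℕ → ℝ) : TaggedPrepartition unitBox where
  boxes := (Finset.range K).map (equiBox K)
  le_of_mem' := by
    intro J hJ
    simp only [Finset.mem_map, Finset.mem_range] at hJ
    obtain ⟨k, hk, rfl⟩ := hJ
    rw [equiBox_apply, Box.le_iff_bounds]
    have hK : (0 : ℝ) < K := by exact_mod_cast NeZero.pos K
    have hk' : (k : ℝ) + 1 ≤ K := by exact_mod_cast hk
    refine ⟨fun i => ?_, fun i => ?_⟩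
    · simp only [unitPartition.box_lower, unitBox]; positivity
    · simp only [unitPartition.box_upper, unitBox]
      rw [div_le_one hK]; exact_mod_cast hk'
  pairwiseDisjoint := by
    intro J hJ J' hJ' hne
    simp only [Finset.coe_map, Set.mem_image] at hJ hJ'
    obtain ⟨k, -, rfl⟩ := hJ
    obtain ⟨k', -, rfl⟩ := hJ'
    exact unitPartition.disjoint.mp fun h => hne (by rw [equiBox_apply, equiBox_apply, h])
  -- The index is recovered from the lower endpoint `k / K`. Clipping keeps the tag in the unit
  -- interval also for boxes outside the partition.
  tag J := fun _ => max 0 (min 1 (s ⌊K * J.lower 0⌋₊))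
  tag_mem_Icc J := by
    rw [Box.Icc_def, Set.mem_Icc]
    exact ⟨fun _ => le_max_left _ _, fun _ => max_le zero_le_one (min_le_left _ _)⟩

open BoxIntegral in
theorem equiPartition_tag {K : ℕ} [NeZero K] {s : ℕ → ℝ} {k : ℕ} (hk : k < K)
    (hs : s k ∈ Set.Icc ((k : ℝ) / K) ((k + 1 : ℝ) / K)) :
    (equiPartition K s).tag (unitPartition.box K fun _ : Fin 1 => (k : ℤ)) = fun _ => s k := by
  have hK : (0 : ℝ) < K := by exact_mod_cast NeZero.pos K
  have hk' : (k : ℝ) + 1 ≤ K := by exact_mod_cast hk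
  ext i
  have h1 : (K : ℝ) * ((unitPartition.box K fun _ : Fin 1 => (k : ℤ)).lower 0) = k := by
    simp only [unitPartition.box_lower, Int.cast_natCast]
    field_simp
  simp only [equiPartition]
  rw [h1, Nat.floor_natCast, min_eq_right, max_eq_right]
  · exact le_trans (by positivity) hs.1
  · exact hs.2.trans ((div_le_one hK).mpr hk')

open BoxIntegral in
theorem integralSum_equiPartition {K : ℕ} [NeZero K] {s : ℕ → ℝ}
    (hs : ∀ k < K, s k ∈ Set.Icc ((k : ℝ) / K) ((k + 1 : ℝ) / K)) (G : ℝ → ℂ) :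
    integralSum (fun t : Fin 1 → ℝ => G (t 0)) BoxAdditiveMap.volume (equiPartition K s)
      = (K : ℂ)⁻¹ * ∑ k ∈ Finset.range K, G (s k) := by
  rw [integralSum, Finset.mul_sum]
  have : (equiPartition K s).boxes = (Finset.range K).map (equiBox K) := rfl
  rw [this, Finset.sum_map]
  refine Finset.sum_congr rfl fun k hk => ?_
  have hk := Finset.mem_range.mp hk
  rw [equiBox_apply, equiPartition_tag hk (hs k hk), BoxAdditiveMap.volume_apply]
  simp only [unitPartition.box.upper_sub_lower, Finset.prod_const, Finset.card_univ,
    Fintype.card_fin, pow_one, one_div]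
  simp

open BoxIntegral in
theorem equiPartition_memBaseSet {K : ℕ} [NeZero K] {s : ℕ → ℝ}
    (hs : ∀ k < K, s k ∈ Set.Icc ((k : ℝ) / K) ((k + 1 : ℝ) / K)) {r : (Fin 1 → ℝ) → Set.Ioi (0 : ℝ)}
    (hr : ∀ x, r x = r 0) (hK : 1 / (K : ℝ) ≤ r 0) :
    IntegrationParams.Riemann.MemBaseSet unitBox 0 r (equiPartition K s) := by
  have hmem : ∀ k < K, (equiPartition K s).tag (unitPartition.box K fun _ : Fin 1 => (k : ℤ)) ∈
      Box.Icc (unitPartition.box K fun _ : Fin 1 => (k : ℤ)) := by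
    intro k hk
    rw [equiPartition_tag hk (hs k hk), Box.Icc_def, Set.mem_Icc]
    have := hs k hk
    refine ⟨fun i => ?_, fun i => ?_⟩
    · simpa using this.1
    · simpa using this.2
  refine ⟨?_, fun _ => ?_, fun h => by simp [IntegrationParams.Riemann] at h,
    fun h => by simp [IntegrationParams.Riemann] at h⟩
  · intro J hJ
    obtain ⟨k, hk, rfl⟩ := Finset.mem_map.mp hJ
    rw [Finset.mem_range] at hk
    intro x hx
    rw [Metric.mem_closedBall, hr]
    refine le_trans (Metric.dist_le_diam_of_mem (Box.isBounded_Icc _) hx (hmem k hk)) ?_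
    exact (unitPartition.diam_boxIcc K _).trans hK
  · intro J hJ
    obtain ⟨k, hk, rfl⟩ := Finset.mem_map.mp hJ
    rw [Finset.mem_range] at hk
    exact hmem k hk

open BoxIntegral in
theorem equiPartition_isPartition (K : ℕ) [NeZero K] (s : ℕ → ℝ) :
    (equiPartition K s).toPrepartition.IsPartition := by
  intro x hx
  have hK : (0 : ℝ) < K := by exact_mod_cast NeZero.pos K
  have hx0 : 0 < x 0 := (hx 0).1
  have hx1 : x 0 ≤ 1 := (hx 0).2
  have h1 : 0 < ⌈(K : ℝ) * x 0⌉ := Int.ceil_pos.mpr (by positivity)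
  have h2 : ⌈(K : ℝ) * x 0⌉ ≤ K := Int.ceil_le.mpr (by push_cast; nlinarith)
  obtain ⟨k, hk⟩ := Int.eq_ofNat_of_zero_le (show 0 ≤ ⌈(K : ℝ) * x 0⌉ - 1 by omega)
  refine ⟨unitPartition.box K fun _ => (k : ℤ), Finset.mem_map.mpr ⟨k, ?_, rfl⟩, ?_⟩
  · rw [Finset.mem_range]; omega
  · rw [unitPartition.mem_box_iff_index]
    ext i
    rw [unitPartition.index_apply, Subsingleton.elim i 0, hk]

open BoxIntegral in
-- For the Riemann integral the gauge is a constant, so every equipartition of small mesh is fine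
-- enough whatever its tags.
theorem RiemannIntegrableCircle.exists_riemannSum_sub_le {g : UnitAddCircle → ℂ}
    (hg : RiemannIntegrableCircle g) {ε : ℝ} (hε : 0 < ε) :
    ∃ K : ℕ, 0 < K ∧ ∀ s t : ℕ → ℝ, (∀ k < K, s k ∈ Set.Icc ((k : ℝ) / K) ((k + 1 : ℝ) / K)) →
      (∀ k < K, t k ∈ Set.Icc ((k : ℝ) / K) ((k + 1 : ℝ) / K)) →
      ‖∑ k ∈ Finset.range K, (g (s k : ℝ) - g (t k : ℝ))‖ ≤ ε * K := by
  have hg' : Integrable unitBox IntegrationParams.Riemann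
    (fun t : Fin 1 → ℝ => g ((t 0 : ℝ) : UnitAddCircle)) BoxAdditiveMap.volume := hg
  set r := hg'.convergenceR (ε / 2) 0 with hr
  have hrc : ∀ x, r x = r 0 := hg'.convergenceR_cond (ε / 2) 0 rfl
  obtain ⟨n, hn⟩ := exists_nat_one_div_lt (show (0 : ℝ) < r 0 from (r 0).2)
  refine ⟨n + 1, Nat.succ_pos n, fun s t hs ht => ?_⟩
  have hK : 1 / ((n + 1 : ℕ) : ℝ) ≤ r 0 := by push_cast; exact hn.le
  have h1 := hg'.dist_integralSum_le_of_memBaseSet (half_pos hε) (half_pos hε)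
    (equiPartition_memBaseSet hs hrc hK) (equiPartition_memBaseSet ht hrc hK)
    ((equiPartition_isPartition _ s).iUnion_eq.trans (equiPartition_isPartition _ t).iUnion_eq.symm)
  rw [integralSum_equiPartition hs fun t => g t, integralSum_equiPartition ht fun t => g t,
    dist_eq_norm, ← mul_sub, ← Finset.sum_sub_distrib, norm_mul, norm_inv, Complex.norm_natCast,
    add_halves, inv_mul_le_iff₀ (by positivity)] at h1
  rw [mul_comm]
  exact h1

theorem RiemannIntegrableCircle.exists_oscillation_bound {g : UnitAddCircle → ℂ}
    (hg : RiemannIntegrableCircle g) {ε : ℝ} (hε : 0 < ε) :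
    ∃ K : ℕ, 0 < K ∧ ∃ o : ℕ → ℝ, (∀ k < K, ∀ x ∈ Set.Icc ((k : ℝ) / K) ((k + 1 : ℝ) / K),
      ∀ y ∈ Set.Icc ((k : ℝ) / K) ((k + 1 : ℝ) / K), ‖g (x : ℝ) - g (y : ℝ)‖ ≤ o k) ∧
      ∑ k ∈ Finset.range K, o k ≤ ε * K := by
  obtain ⟨K, hK, hsum⟩ := hg.exists_riemannSum_sub_le (show 0 < ε / 3 by positivity)
  refine ⟨K, hK, ?_⟩
  set I : ℕ → Set ℝ := fun k => Set.Icc ((k : ℝ) / K) ((k + 1 : ℝ) / K) with hI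
  have hKr : (0 : ℝ) < K := by exact_mod_cast hK
  have hne : ∀ k : ℕ, (k : ℝ) / K ∈ I k := fun k =>
    ⟨le_rfl, by gcongr; linarith⟩
  -- Exchanging the two tags wherever the difference is negative makes all terms of the signed sum
  -- nonnegative. This is used for the real and the imaginary part, each costing `ε / 3`.
  have hpart : ∀ φ : ℂ →+ ℝ, (∀ z, |φ z| ≤ ‖z‖) → ∀ s t : ℕ → ℝ, (∀ k < K, s k ∈ I k) →
      (∀ k < K, t k ∈ I k) →
      ∑ k ∈ Finset.range K, |φ (g (s k : ℝ) - g (t k : ℝ))| ≤ ε / 3 * K := by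
    intro φ hφ s t hs ht
    set p : ℕ → Prop := fun k => 0 ≤ φ (g (s k : ℝ) - g (t k : ℝ)) with hp
    classical
    have h1 := hsum (fun k => if p k then s k else t k) (fun k => if p k then t k else s k)
      (fun k hk => by split_ifs; exacts [hs k hk, ht k hk])
      (fun k hk => by split_ifs; exacts [ht k hk, hs k hk])
    refine le_trans ?_ ((hφ _).trans h1)
    rw [map_sum]
    refine le_trans (Finset.sum_le_sum fun k _ => ?_) (le_abs_self _)
    by_cases h : p k
    · simp only [if_pos h]
      exact (abs_of_nonneg h).le
    · simp only [if_neg h]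
      have h' : φ (g (s k : ℝ) - g (t k : ℝ)) < 0 := not_le.mp h
      rw [abs_of_neg h', ← map_neg, neg_sub]
  have habs : ∀ s t : ℕ → ℝ, (∀ k < K, s k ∈ I k) → (∀ k < K, t k ∈ I k) →
      ∑ k ∈ Finset.range K, ‖g (s k : ℝ) - g (t k : ℝ)‖ ≤ 2 * (ε / 3) * K := by
    intro s t hs ht
    have h1 := hpart Complex.reAddGroupHom Complex.abs_re_le_norm s t hs ht
    have h2 := hpart Complex.imAddGroupHom Complex.abs_im_le_norm s t hs ht
    calc _ ≤ ∑ k ∈ Finset.range K, (|(g (s k : ℝ) - g (t k : ℝ)).re|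
          + |(g (s k : ℝ) - g (t k : ℝ)).im|) :=
        Finset.sum_le_sum fun k _ => Complex.norm_le_abs_re_add_abs_im _
      _ ≤ ε / 3 * K + ε / 3 * K := by
        rw [Finset.sum_add_distrib]
        exact add_le_add h1 h2
      _ = _ := by ring
  -- Taking equal tags in all other intervals leaves a single term, so the oscillations are finite
  -- and the suprema below are genuine.
  have hbdd : ∀ k < K, ∀ x ∈ I k, ∀ y ∈ I k, ‖g (x : ℝ) - g (y : ℝ)‖ ≤ 2 * (ε / 3) * K := by
    intro k hk x hx y hy
    have h1 := habs (Function.update (fun j : ℕ => (j : ℝ) / K) k x)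
      (Function.update (fun j : ℕ => (j : ℝ) / K) k y) (fun j _ => by
        rcases eq_or_ne j k with rfl | h
        · simpa using hx
        · simpa [h] using hne j) (fun j _ => by
        rcases eq_or_ne j k with rfl | h
        · simpa using hy
        · simpa [h] using hne j)
    refine le_trans ?_ h1
    refine le_trans ?_ (Finset.single_le_sum (fun j _ => norm_nonneg _) (Finset.mem_range.mpr hk))
    simp
  set A : ℕ → Set ℝ := fun k => {v | ∃ x ∈ I k, ∃ y ∈ I k, v = ‖g (x : ℝ) - g (y : ℝ)‖} with hA
  have hAne : ∀ k, (A k).Nonempty := fun k => ⟨_, _, hne k, _, hne k, rfl⟩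
  have hAb : ∀ k < K, BddAbove (A k) := by
    rintro k hk
    refine ⟨2 * (ε / 3) * K, ?_⟩
    rintro _ ⟨x, hx, y, hy, rfl⟩
    exact hbdd k hk x hx y hy
  refine ⟨fun k => sSup (A k), fun k hk x hx y hy => le_csSup (hAb k hk) ⟨x, hx, y, hy, rfl⟩, ?_⟩
  choose v hv hvs using fun k => exists_lt_of_lt_csSup (hAne k)
    (show sSup (A k) - ε / 3 < sSup (A k) by linarith)
  choose x hx y hy hxy using hv
  have h1 := habs x y (fun k _ => hx k) (fun k _ => hy k)
  calc ∑ k ∈ Finset.range K, sSup (A k)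
      ≤ ∑ k ∈ Finset.range K, (‖g (x k : ℝ) - g (y k : ℝ)‖ + ε / 3) :=
        Finset.sum_le_sum fun k _ => by have := hvs k; rw [hxy] at this; linarith
    _ ≤ 2 * (ε / 3) * K + K * (ε / 3) := by
        rw [Finset.sum_add_distrib]
        simpa using h1
    _ = ε * K := by ring

/-! ### Continuous sandwiching of Riemann integrable functions -/

/-- The hat function supported on `[-1, 1]`. -/
noncomputable def hat (t : ℝ) : ℝ := max 0 (1 - |t|)

theorem continuous_hat : Continuous hat := by unfold hat; fun_prop

theorem hat_nonneg (t : ℝ) : 0 ≤ hat t := le_max_left _ _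

theorem hat_eq_zero {t : ℝ} (ht : 1 ≤ |t|) : hat t = 0 := max_eq_left (by linarith)

theorem hat_le_one (t : ℝ) : hat t ≤ 1 := max_le zero_le_one (by linarith [abs_nonneg t])

theorem sum_hat {K : ℕ} {u : ℝ} (h0 : 0 ≤ u) (h1 : u < K) :
    ∑ k ∈ Finset.range (K + 1), hat (u - k) = 1 := by
  set n := ⌊u⌋₊
  have hn1 : (n : ℝ) ≤ u := Nat.floor_le h0
  have hn2 : u < n + 1 := Nat.lt_floor_add_one u
  have hnK : n < K := by exact_mod_cast hn1.trans_lt h1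
  rw [Finset.sum_eq_add_of_mem n (n + 1) (by simp; omega) (by simp; omega) (by omega)]
  · have e1 : hat (u - n) = 1 - (u - n) := by
      rw [hat, abs_of_nonneg (by linarith), max_eq_right (by linarith)]
    have e2 : hat (u - (n + 1 : ℕ)) = u - n := by
      push_cast
      rw [hat, abs_of_nonpos (by linarith), max_eq_right (by linarith)]
      ring
    rw [e1, e2]; ring
  · intro k _ hk
    apply hat_eq_zero
    rcases lt_or_ge k n with h | h
    · have : (k : ℝ) + 1 ≤ n := by exact_mod_cast h
      rw [abs_of_nonneg (by linarith)]; linarith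
    · have : (n : ℝ) + 2 ≤ k := by
        have : n + 2 ≤ k := by omega
        exact_mod_cast this
      rw [abs_of_nonpos (by linarith)]; linarith

theorem integral_hat_le {K : ℕ} (hK : 0 < K) (k : ℕ) :
    ∫ t in (0 : ℝ)..1, hat (K * t - k) ≤ 2 / K := by
  have hKr : (0 : ℝ) < K := by exact_mod_cast hK
  rw [intervalIntegral.integral_comp_mul_sub hat hKr.ne', mul_zero, mul_one, zero_sub,
    smul_eq_mul]
  have h1 : ∫ x in (-(k : ℝ))..(K - k), hat x ≤ 2 := by
    rw [intervalIntegral.integral_of_le (by linarith)]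
    calc ∫ x in Set.Ioc (-(k : ℝ)) (K - k), hat x
        ≤ ∫ x in Set.Ioc (-(k : ℝ)) (K - k), (Set.Icc (-1 : ℝ) 1).indicator (fun _ => (1 : ℝ)) x := by
          refine integral_mono ?_ ?_ fun x => ?_
          · exact (continuous_hat.integrableOn_Icc).mono_set Set.Ioc_subset_Icc_self
          · exact (integrable_const (1 : ℝ)).indicator measurableSet_Icc
          · by_cases hx : x ∈ Set.Icc (-1 : ℝ) 1
            · simpa [hx] using hat_le_one x
            · rw [Set.indicator_of_notMem hx]
              refine (hat_eq_zero ?_).le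
              by_contra! hlt
              exact hx (abs_le.mp hlt.le)
      _ ≤ ∫ x, (Set.Icc (-1 : ℝ) 1).indicator (fun _ => (1 : ℝ)) x := by
          refine setIntegral_le_integral ?_ (ae_of_all _ fun x => ?_)
          · exact (integrable_indicator_iff measurableSet_Icc).mpr
              (integrableOn_const (by simp))
          · exact Set.indicator_nonneg (fun _ _ => zero_le_one) x
      _ = 2 := by
          rw [integral_indicator measurableSet_Icc]
          simp
          norm_num
  rw [div_eq_inv_mul]
  exact mul_le_mul_of_nonneg_left h1 (by positivity)

/-- Piecewise linear interpolation of the values `a k` at the nodes `k / K`. -/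
noncomputable def interp {V : Type*} [NormedAddCommGroup V] [NormedSpace ℝ V] (K : ℕ) (a : ℕ → V)
    (t : ℝ) : V := ∑ k ∈ Finset.range (K + 1), hat (K * t - k) • a k

section Interp

variable {V : Type*} [NormedAddCommGroup V] [NormedSpace ℝ V] {K : ℕ} {a : ℕ → V}

theorem continuous_interp : Continuous (interp K a) := by
  unfold interp
  exact continuous_finsetSum _ fun k _ =>
    (continuous_hat.comp (by fun_prop)).smul continuous_const

theorem interp_zero_eq_interp_one (ha : a 0 = a K) : interp K a 0 = interp K a 1 := by
  have h1 : ∀ n ≤ K, ∑ k ∈ Finset.range (K + 1), hat ((n : ℝ) - k) • a k = a n := by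
    intro n hn
    rw [Finset.sum_eq_single n]
    · simp [hat]
    · intro k _ hk
      rw [hat_eq_zero, zero_smul]
      have : (1 : ℤ) ≤ |(n : ℤ) - k| := Int.one_le_abs (by omega)
      exact_mod_cast this
    · intro h; simp at h; omega
  have h2 := h1 0 (Nat.zero_le _)
  have h3 := h1 K le_rfl
  simp only [interp, mul_zero, mul_one]
  rw [h3, ← ha]
  simpa using h2

end Interp

/-- `c` interpolates `g` linearly at the nodes `k / K`, and `w` interpolates the sums of the
oscillations on the two intervals meeting at a node. Since the hat functions are a partition of
unity, `g - c` at `t` involves only nodes of the interval containing `t`. -/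
theorem RiemannIntegrableCircle.exists_continuous_sandwich {g : UnitAddCircle → ℂ}
    (hg : RiemannIntegrableCircle g) {ε : ℝ} (hε : 0 < ε) :
    ∃ (c : C(UnitAddCircle, ℂ)) (w : C(UnitAddCircle, ℝ)), (∀ θ, ‖g θ - c θ‖ ≤ w θ) ∧
      ∫ θ, w θ ≤ ε := by
  obtain ⟨K, hK, o, ho, hsum⟩ := hg.exists_oscillation_bound (show 0 < ε / 8 by positivity)
  have hKr : (0 : ℝ) < K := by exact_mod_cast hK
  have ho0 : ∀ k < K, 0 ≤ o k := fun k hk => by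
    have h : (k : ℝ) / K ∈ Set.Icc ((k : ℝ) / K) ((k + 1 : ℝ) / K) :=
      ⟨le_rfl, by gcongr; linarith⟩
    simpa using ho k hk _ h _ h
  -- `(k + (K - 1)) % K` is the cyclic predecessor of `k`; the periodicity lets the interpolation
  -- close up on the circle.
  set b : ℕ → ℝ := fun k => o ((k + (K - 1)) % K) + o (k % K) with hb
  set a : ℕ → ℂ := fun k => g ((k / K : ℝ) : ℝ) with ha
  have ha0 : a 0 = a K := by
    simp only [ha, Nat.cast_zero, zero_div, div_self hKr.ne']
    congr 1
    have := intCast_unitAddCircle 1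
    push_cast at this ⊢
    exact this.symm
  have hb0 : b 0 = b K := by
    simp only [hb, zero_add, Nat.zero_mod, Nat.mod_self, Nat.add_mod_left]
  have hbnn : ∀ k, 0 ≤ b k := fun k =>
    add_nonneg (ho0 _ (Nat.mod_lt _ hK)) (ho0 _ (Nat.mod_lt _ hK))
  have hone : ((0 : ℝ) + 1) = 1 := zero_add 1
  set c : C(UnitAddCircle, ℂ) := ⟨AddCircle.liftIco 1 0 (interp K a), AddCircle.liftIco_continuous
    (by rw [hone]; exact interp_zero_eq_interp_one ha0) continuous_interp.continuousOn⟩ with hc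
  set w : C(UnitAddCircle, ℝ) := ⟨AddCircle.liftIco 1 0 (interp K b), AddCircle.liftIco_continuous
    (by rw [hone]; exact interp_zero_eq_interp_one hb0) continuous_interp.continuousOn⟩ with hw
  have hcv : ∀ t ∈ Set.Ico (0 : ℝ) 1, c (t : UnitAddCircle) = interp K a t := fun t ht =>
    AddCircle.liftIco_coe_apply (f := interp K a) (a := 0) (p := 1) (by rwa [hone])
  have hwv : ∀ t ∈ Set.Ico (0 : ℝ) 1, w (t : UnitAddCircle) = interp K b t := fun t ht =>
    AddCircle.liftIco_coe_apply (f := interp K b) (a := 0) (p := 1) (by rwa [hone])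
  refine ⟨c, w, fun θ => ?_, ?_⟩
  · obtain ⟨t, ht, rfl⟩ : ∃ t ∈ Set.Ico (0 : ℝ) 1, (t : UnitAddCircle) = θ := by
      have := AddCircle.coe_image_Ico_eq (1 : ℝ) 0
      rw [hone] at this
      simpa using this.symm.subset (Set.mem_univ θ)
    rw [hcv t ht, hwv t ht]
    have hKt : (K : ℝ) * t < K := by nlinarith [ht.2]
    have hKt0 : 0 ≤ (K : ℝ) * t := mul_nonneg hKr.le ht.1
    have e1 : g (t : ℝ) - interp K a t
        = ∑ k ∈ Finset.range (K + 1), hat (K * t - k) • (g (t : ℝ) - a k) := by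
      simp only [smul_sub, Finset.sum_sub_distrib, ← Finset.sum_smul]
      rw [sum_hat hKt0 hKt, one_smul, interp]
    rw [e1, interp]
    refine norm_sum_le_of_le _ fun k hk => ?_
    rw [Finset.mem_range] at hk
    rw [norm_smul, Real.norm_of_nonneg (hat_nonneg _), smul_eq_mul]
    rcases le_or_gt 1 |(K : ℝ) * t - k| with hfar | hnear
    · rw [hat_eq_zero hfar, zero_mul, zero_mul]
    refine mul_le_mul_of_nonneg_left ?_ (hat_nonneg _)
    rw [abs_lt] at hnear
    rcases le_or_gt (k : ℝ) (K * t) with hle | hlt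
    · have hkK : k < K := by exact_mod_cast hle.trans_lt hKt
      have h1 := ho k hkK t ⟨by rw [div_le_iff₀ hKr]; linarith, by rw [le_div_iff₀ hKr]; linarith⟩
        ((k : ℝ) / K) ⟨le_rfl, by gcongr; linarith⟩
      refine h1.trans ?_
      simp only [hb, Nat.mod_eq_of_lt hkK]
      linarith [ho0 ((k + (K - 1)) % K) (Nat.mod_lt _ hK)]
    · obtain ⟨j, rfl⟩ : ∃ j, k = j + 1 := by
        refine ⟨k - 1, ?_⟩
        have : 0 < k := by exact_mod_cast hKt0.trans_lt hlt
        omega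
      push_cast at hlt hnear
      have hjK : j < K := by omega
      have h1 := ho j hjK t ⟨by rw [div_le_iff₀ hKr]; linarith, by rw [le_div_iff₀ hKr]; linarith⟩
        (((j + 1 : ℕ) : ℝ) / K) ⟨by gcongr; linarith, by push_cast; rfl⟩
      refine h1.trans ?_
      have h2 : (j + 1 + (K - 1)) % K = j := by
        rw [show j + 1 + (K - 1) = j + K by omega, Nat.add_mod_right, Nat.mod_eq_of_lt hjK]
      simp only [hb, h2]
      linarith [ho0 ((j + 1) % K) (Nat.mod_lt _ hK)]
  · have e1 : ∫ θ, w θ = ∫ t in (0 : ℝ)..1, interp K b t := by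
      rw [← UnitAddCircle.intervalIntegral_preimage 0, hone]
      refine intervalIntegral.integral_congr_ae ?_
      have : ∀ᵐ t : ℝ, t ≠ 1 := by
        rw [ae_iff]; simp
      filter_upwards [this] with t ht hmem
      rw [Set.uIoc_of_le zero_le_one] at hmem
      exact hwv t ⟨hmem.1.le, lt_of_le_of_ne hmem.2 ht⟩
    have e2 : ∫ t in (0 : ℝ)..1, interp K b t
        = ∑ k ∈ Finset.range (K + 1), (∫ t in (0 : ℝ)..1, hat (K * t - k)) * b k := by
      simp only [interp, smul_eq_mul]
      rw [intervalIntegral.integral_finsetSum]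
      · simp only [intervalIntegral.integral_mul_const]
      · intro k _
        exact ((continuous_hat.comp (by fun_prop)).mul continuous_const).intervalIntegrable _ _
    have e3 : ∑ k ∈ Finset.range (K + 1), b k ≤ 4 * ∑ k ∈ Finset.range K, o k := by
      have h1 : ∑ k ∈ Finset.range (K + 1), o (k % K) ≤ 2 * ∑ k ∈ Finset.range K, o k := by
        rw [Finset.sum_range_succ, Nat.mod_self, two_mul]
        refine add_le_add (Finset.sum_le_sum fun k hk => ?_) ?_
        · rw [Nat.mod_eq_of_lt (Finset.mem_range.mp hk)]
        · exact Finset.single_le_sum (f := o) (fun k hk => ho0 k (Finset.mem_range.mp hk))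
            (Finset.mem_range.mpr hK)
      have h2 : ∑ k ∈ Finset.range (K + 1), o ((k + (K - 1)) % K)
          ≤ 2 * ∑ k ∈ Finset.range K, o k := by
        rw [Finset.sum_range_succ', two_mul]
        refine add_le_add (Finset.sum_le_sum fun k hk => ?_) ?_
        · have hk := Finset.mem_range.mp hk
          rw [show k + 1 + (K - 1) = k + K by omega, Nat.add_mod_right, Nat.mod_eq_of_lt hk]
        · exact Finset.single_le_sum (f := o) (fun k hk => ho0 k (Finset.mem_range.mp hk))
            (Finset.mem_range.mpr (Nat.mod_lt _ hK))
      simp only [hb, Finset.sum_add_distrib]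
      linarith
    rw [e1, e2]
    calc _ ≤ ∑ k ∈ Finset.range (K + 1), (2 / K : ℝ) * b k :=
          Finset.sum_le_sum fun k _ => mul_le_mul_of_nonneg_right (integral_hat_le hK k) (hbnn k)
      _ = (2 / K : ℝ) * ∑ k ∈ Finset.range (K + 1), b k := by rw [Finset.mul_sum]
      _ ≤ (2 / K : ℝ) * (4 * (ε / 8 * K)) := by
          refine mul_le_mul_of_nonneg_left (e3.trans ?_) (by positivity)
          linarith
      _ = ε := by field_simp; ring

/-! ### Averages weighted by a Riemann integrable function -/

/-- Sandwiches with errors `2^{-n}` have summable integrals, so `w n → 0` almost everywhere and `g`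
is an a.e. limit of continuous functions. -/
theorem RiemannIntegrableCircle.aestronglyMeasurable {g : UnitAddCircle → ℂ}
    (hg : RiemannIntegrableCircle g) : AEStronglyMeasurable g volume := by
  choose c w hcw hw using fun n : ℕ =>
    hg.exists_continuous_sandwich (show (0 : ℝ) < (1 / 2) ^ n by positivity)
  have hw0 : ∀ n θ, 0 ≤ w n θ := fun n θ => (norm_nonneg _).trans (hcw n θ)
  have hint : ∀ n, Integrable (w n) volume := fun n =>
    (w n).continuous.integrable_of_hasCompactSupport (HasCompactSupport.of_compactSpace _)
  have h1 : ∫⁻ θ, ∑' n, ENNReal.ofReal (w n θ) ≠ ⊤ := by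
    rw [lintegral_tsum fun n => (w n).continuous.measurable.ennreal_ofReal.aemeasurable]
    have : ∀ n, ∫⁻ θ, ENNReal.ofReal (w n θ) ≤ (1 / 2) ^ n := by
      intro n
      rw [← ofReal_integral_eq_lintegral_ofReal (hint n) (ae_of_all _ (hw0 n))]
      refine (ENNReal.ofReal_le_ofReal (hw n)).trans ?_
      rw [ENNReal.ofReal_pow (by norm_num)]
      gcongr
      rw [ENNReal.ofReal_div_of_pos (by norm_num)]
      simp
    refine ne_top_of_le_ne_top ?_ (ENNReal.tsum_le_tsum this)
    rw [ENNReal.tsum_geometric]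
    simp
  have h2 := ae_lt_top' (AEMeasurable.tsum fun n =>
    (w n).continuous.measurable.ennreal_ofReal.aemeasurable) h1
  refine aestronglyMeasurable_of_tendsto_ae atTop (f := fun n => c n)
    (fun n => (c n).continuous.aestronglyMeasurable) ?_
  filter_upwards [h2] with θ hθ
  have h3 := ENNReal.tendsto_atTop_zero_of_tsum_ne_top hθ.ne
  have h4 : Tendsto (fun n => w n θ) atTop (𝓝 0) := by
    have := (ENNReal.tendsto_toReal ENNReal.zero_ne_top).comp h3
    simpa [Function.comp_def, ENNReal.toReal_ofReal (hw0 _ θ)] using this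
  rw [tendsto_iff_norm_sub_tendsto_zero]
  exact squeeze_zero (fun n => norm_nonneg _) (fun n => by rw [norm_sub_rev]; exact hcw n θ) h4

theorem ContinuousMap.integrable_unitAddCircle {V : Type*} [NormedAddCommGroup V]
    (c : C(UnitAddCircle, V)) : Integrable c volume :=
  c.continuous.integrable_of_hasCompactSupport (HasCompactSupport.of_compactSpace _)

theorem norm_integral_unitAddCircle_le {V : Type*} [NormedAddCommGroup V] [NormedSpace ℝ V]
    {f : UnitAddCircle → V} {δ : ℝ} (h : ∀ θ, ‖f θ‖ ≤ δ) : ‖∫ θ, f θ‖ ≤ δ := by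
  have := norm_integral_le_of_norm_le_const (μ := (volume : Measure UnitAddCircle))
    (ae_of_all _ h)
  simpa [measureReal_def] using this

/-- Subtracting the integral removes the zero frequency. The other characters are covered by `htw`,
and trigonometric polynomials are uniformly dense. -/
theorem cesaroNull_continuous_sub_integral {x : ℕ → UnitAddCircle} {J : ℕ → ℂ} {C : ℝ}
    (hJ : ∀ n, ‖J n‖ ≤ C) (htw : ∀ m : ℤ, m ≠ 0 → CesaroNull fun n => phase (m • x n) * J n)
    (c : C(UnitAddCircle, ℂ)) : CesaroNull fun n => (c (x n) - ∫ θ, c θ) * J n := by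
  have hC : 0 ≤ C := (norm_nonneg _).trans (hJ 0)
  have hspan : ∀ v ∈ Submodule.span ℂ (Set.range (fourier (T := 1))),
      CesaroNull fun n => (v (x n) - ∫ θ, v θ) * J n := by
    intro v hv
    induction hv using Submodule.span_induction with
    | mem v hv =>
      obtain ⟨m, rfl⟩ := hv
      rcases eq_or_ne m 0 with rfl | hm
      · refine cesaroNull_zero.congr fun N => ?_
        congr 1
        refine Finset.sum_congr rfl fun n _ => ?_
        simp [measureReal_def]
      · have h0 : ∫ θ : UnitAddCircle, fourier m θ = 0 :=
          integral_eq_zero_of_add_right_eq_neg (fourier_add_half_inv_index hm one_pos)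
        rw [h0]
        refine (htw m hm).congr fun N => ?_
        simp [fourier_apply, phase]
    | zero => simpa using cesaroNull_zero
    | add u v _ _ hu hv =>
      refine (hu.add hv).congr fun N => ?_
      congr 1
      refine Finset.sum_congr rfl fun n _ => ?_
      simp only [ContinuousMap.add_apply]
      rw [integral_add u.integrable_unitAddCircle v.integrable_unitAddCircle]
      ring
    | smul a v _ hv =>
      refine (hv.const_mul a).congr fun N => ?_
      congr 1
      refine Finset.sum_congr rfl fun n _ => ?_
      simp only [ContinuousMap.smul_apply, smul_eq_mul]
      rw [integral_const_mul]
      ring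
  refine cesaroNull_of_approx fun ε hε => ?_
  have hmem : c ∈ (Submodule.span ℂ (Set.range (fourier (T := 1)))).topologicalClosure := by
    rw [span_fourier_closure_eq_top]; trivial
  obtain ⟨v, hv, hcv⟩ := Metric.mem_closure_iff.mp hmem (ε / (2 * (C + 1))) (by positivity)
  refine ⟨_, hspan v hv, Eventually.of_forall fun N => ?_⟩
  have hd : ∀ θ, ‖c θ - v θ‖ ≤ ε / (2 * (C + 1)) := fun θ => by
    rw [← dist_eq_norm]
    exact (ContinuousMap.dist_apply_le_dist θ).trans hcv.le
  have hi : ‖(∫ θ, c θ) - ∫ θ, v θ‖ ≤ ε / (2 * (C + 1)) := by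
    rw [← integral_sub c.integrable_unitAddCircle v.integrable_unitAddCircle]
    exact norm_integral_unitAddCircle_le hd
  refine (Finset.sum_le_card_nsmul _ _ ε fun n _ => ?_).trans (by simp [mul_comm])
  have e : (c (x n) - ∫ θ, c θ) * J n - (v (x n) - ∫ θ, v θ) * J n
      = ((c (x n) - v (x n)) - ((∫ θ, c θ) - ∫ θ, v θ)) * J n := by ring
  rw [e, norm_mul]
  calc _ ≤ (ε / (2 * (C + 1)) + ε / (2 * (C + 1))) * C :=
        mul_le_mul ((norm_sub_le _ _).trans (add_le_add (hd _) hi)) (hJ n) (norm_nonneg _)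
          (by positivity)
    _ ≤ (ε / (2 * (C + 1)) + ε / (2 * (C + 1))) * (C + 1) := by
        gcongr; linarith
    _ = ε := by field_simp; ring

/-- Replacing `g` by `c` costs `w (x n)` at time `n`. By equidistribution, the case `J = 1`, this
averages to about `∫ w ≤ δ`. One `δ` for this limit, one for the integral of `w` and one for that of
`c` make up `3δ`. -/
theorem cesaroNull_riemannIntegrable_mul {x : ℕ → UnitAddCircle} {J : ℕ → ℂ} {C : ℝ}
    (hJ : ∀ n, ‖J n‖ ≤ C) (hequi : ∀ m : ℤ, m ≠ 0 → CesaroNull fun n => phase (m • x n))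
    (htw : ∀ m : ℤ, m ≠ 0 → CesaroNull fun n => phase (m • x n) * J n)
    {g : UnitAddCircle → ℂ} (hg : RiemannIntegrableCircle g) (hg0 : ∫ θ, g θ = 0) :
    CesaroNull fun n => g (x n) * J n := by
  have hC : 0 ≤ C := (norm_nonneg _).trans (hJ 0)
  refine cesaroNull_of_approx fun ε hε => ?_
  set δ := ε / (3 * (C + 1)) with hδ
  have hδ0 : 0 < δ := by positivity
  obtain ⟨c, w, hcw, hw⟩ := hg.exists_continuous_sandwich hδ0
  refine ⟨_, cesaroNull_continuous_sub_integral hJ htw c, ?_⟩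
  have hgint : Integrable g volume := by
    have h1 : Integrable (fun θ => g θ - c θ) volume :=
      w.integrable_unitAddCircle.mono'
        (hg.aestronglyMeasurable.sub c.continuous.aestronglyMeasurable) (ae_of_all _ hcw)
    exact (h1.add c.integrable_unitAddCircle).congr (ae_of_all _ fun θ => by simp)
  have hcint : ‖∫ θ, c θ‖ ≤ δ := by
    have h1 : ∫ θ, (g θ - c θ) = -∫ θ, c θ := by
      rw [integral_sub hgint c.integrable_unitAddCircle, hg0, zero_sub]
    rw [← norm_neg, ← h1]
    exact (norm_integral_le_of_norm_le w.integrable_unitAddCircle (ae_of_all _ hcw)).trans hw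
  have hwc := cesaroNull_continuous_sub_integral (J := fun _ => 1) (C := 1) (fun _ => by simp)
    (fun m hm => by simpa using hequi m hm) ⟨fun θ => (w θ : ℂ), by fun_prop⟩
  have hwc' := (Metric.tendsto_atTop.mp hwc) δ hδ0
  obtain ⟨N₀, hN₀⟩ := hwc'
  filter_upwards [eventually_ge_atTop N₀, eventually_gt_atTop 0] with N hN hN0
  have hNr : (0 : ℝ) < N := by exact_mod_cast hN0
  have h1 := hN₀ N hN
  have hcoe : ∫ θ, ((w θ : ℝ) : ℂ) = ((∫ θ, w θ : ℝ) : ℂ) := integral_ofReal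
  simp only [ContinuousMap.coe_mk, mul_one] at h1
  rw [dist_zero_right, norm_mul, norm_div, norm_one, Complex.norm_natCast, one_div,
    inv_mul_lt_iff₀ hNr, hcoe] at h1
  have h2 : ∑ n ∈ Finset.range N, (w (x n) - ∫ θ, w θ) ≤ N * δ := by
    refine (le_abs_self _).trans (le_trans (le_of_eq ?_) h1.le)
    rw [← Real.norm_eq_abs, ← Complex.norm_real]
    push_cast
    rfl
  have h3 : ∑ n ∈ Finset.range N, w (x n) ≤ 2 * δ * N := by
    rw [Finset.sum_sub_distrib] at h2
    simp only [Finset.sum_const, Finset.card_range, nsmul_eq_mul] at h2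
    have : (N : ℝ) * ∫ θ, w θ ≤ N * δ := by gcongr
    linarith
  calc ∑ n ∈ Finset.range N, ‖g (x n) * J n - (c (x n) - ∫ θ, c θ) * J n‖
      ≤ ∑ n ∈ Finset.range N, (w (x n) + δ) * C := by
        refine Finset.sum_le_sum fun n _ => ?_
        have e : g (x n) * J n - (c (x n) - ∫ θ, c θ) * J n
            = ((g (x n) - c (x n)) + ∫ θ, c θ) * J n := by ring
        rw [e, norm_mul]
        exact mul_le_mul ((norm_add_le _ _).trans (add_le_add (hcw _) hcint)) (hJ n) (norm_nonneg _)
          (add_nonneg ((norm_nonneg _).trans (hcw _)) hδ0.le)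
    _ = (∑ n ∈ Finset.range N, w (x n) + N * δ) * C := by
        rw [← Finset.sum_mul, Finset.sum_add_distrib]
        simp
    _ ≤ (2 * δ * N + N * δ) * (C + 1) :=
        mul_le_mul (by linarith) (by linarith) hC (by positivity)
    _ = ε * N := by rw [hδ]; field_simp; ring

/-! ### Approximation by phase polynomials -/

section Slots

theorem exists_ae_norm_le_of_memLp_top {X : Type*} [MeasurableSpace X] {μ : Measure X}
    {f : X → ℂ} (hf : MemLp f ⊤ μ) : ∃ C : ℝ, ∀ᵐ x ∂μ, ‖f x‖ ≤ C := by
  refine ⟨(eLpNorm f ⊤ μ).toReal, ?_⟩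
  filter_upwards [ae_le_eLpNormEssSup (f := f) (μ := μ)] with x hx
  rw [← toReal_enorm, eLpNorm_exponent_top]
  exact ENNReal.toReal_mono (by rw [← eLpNorm_exponent_top]; exact hf.eLpNorm_lt_top.ne) hx

variable {X : Type*} [TopologicalSpace X]

theorem measurePreserving_zpow [MeasurableSpace X] [BorelSpace X] {μ : Measure X} {T : X ≃ₜ X}
    (hT : MeasurePreserving T μ μ) (n : ℤ) : MeasurePreserving (T ^ n : X ≃ₜ X) μ μ := by
  have hT' : MeasurePreserving (T⁻¹ : X ≃ₜ X) μ μ := hT.symm (e := T.toMeasurableEquiv)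
  induction n using Int.induction_on with
  | zero => exact MeasurePreserving.id μ
  | succ n ih => rw [zpow_add_one]; exact ih.comp hT
  | pred n ih => rw [zpow_sub_one]; exact ih.comp hT'

/-- The function `x ↦ exp(2πi φ(x))`. -/
noncomputable def phaseFun (φ : C(X, UnitAddCircle)) : C(X, ℂ) :=
  ⟨fun x => phase (φ x), continuous_phase.comp φ.continuous⟩

theorem phaseFun_apply (φ : C(X, UnitAddCircle)) (x : X) : phaseFun φ x = phase (φ x) := rfl

/-- `P` is a group, so products of its phase functions are again phase functions. -/
theorem adjoin_phaseFun_eq_span (P : AddSubgroup C(X, UnitAddCircle)) :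
    Subalgebra.toSubmodule (Algebra.adjoin ℂ (phaseFun '' (P : Set C(X, UnitAddCircle)))) =
      Submodule.span ℂ (phaseFun '' (P : Set C(X, UnitAddCircle))) := by
  apply Algebra.adjoin_eq_span_of_subset
  refine Set.Subset.trans ?_ Submodule.subset_span
  intro x hx
  refine Submonoid.closure_induction (fun _ => id) ⟨0, P.zero_mem, ?_⟩ ?_ hx
  · ext z; simp [phaseFun_apply, phase_zero]
  · rintro - - - - ⟨φ, hφ, rfl⟩ ⟨ψ, hψ, rfl⟩
    exact ⟨φ + ψ, P.add_mem hφ hψ, by ext z; simp [phaseFun_apply, phase_add]⟩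

theorem span_phaseFun_closure_eq_top [CompactSpace X] (P : AddSubgroup C(X, UnitAddCircle))
    (hsep : ∀ x y : X, x ≠ y → ∃ φ ∈ P, φ x ≠ φ y) :
    (Submodule.span ℂ (phaseFun '' (P : Set C(X, UnitAddCircle)))).topologicalClosure = ⊤ := by
  let A : StarSubalgebra ℂ C(X, ℂ) :=
    { toSubalgebra := Algebra.adjoin ℂ (phaseFun '' (P : Set C(X, UnitAddCircle)))
      star_mem' := by
        change Algebra.adjoin ℂ (phaseFun '' (P : Set C(X, UnitAddCircle))) ≤
          star (Algebra.adjoin ℂ (phaseFun '' (P : Set C(X, UnitAddCircle))))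
        refine Algebra.adjoin_le ?_
        rintro - ⟨φ, hφ, rfl⟩
        exact Algebra.subset_adjoin ⟨-φ, P.neg_mem hφ, by
          ext x; simp [phaseFun_apply, phase_neg]⟩ }
  have hA : A.SeparatesPoints := by
    intro x y hxy
    obtain ⟨φ, hφ, hne⟩ := hsep x y hxy
    exact ⟨_, ⟨phaseFun φ, Algebra.subset_adjoin ⟨φ, hφ, rfl⟩, rfl⟩,
      fun h => hne (phase_injective h)⟩
  rw [← adjoin_phaseFun_eq_span]
  exact congr_arg (Subalgebra.toSubmodule <| StarSubalgebra.toSubalgebra ·)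
    (ContinuousMap.starSubalgebra_topologicalClosure_eq_top_of_separatesPoints A hA)

variable [MeasurableSpace X] [BorelSpace X] {μ : Measure X}

theorem integrable_comp_zpow_mul {T : X ≃ₜ X} (hT : MeasurePreserving T μ μ) (k : ℤ)
    {b : X → ℂ} {C : ℝ} (hb : ∀ᵐ x ∂μ, ‖b x‖ ≤ C) (hbm : AEStronglyMeasurable b μ)
    {f : X → ℂ} (hf : Integrable f μ) : Integrable (fun x => f ((T ^ k) x) * b x) μ :=
  ((measurePreserving_zpow hT k).integrable_comp_of_integrable hf).mul_bdd hbm hb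

theorem norm_integral_comp_zpow_mul_le {T : X ≃ₜ X} (hT : MeasurePreserving T μ μ) (k : ℤ)
    {b : X → ℂ} {C : ℝ} (hb : ∀ᵐ x ∂μ, ‖b x‖ ≤ C)
    {f : X → ℂ} (hf : Integrable f μ) :
    ‖∫ x, f ((T ^ k) x) * b x ∂μ‖ ≤ (∫ x, ‖f x‖ ∂μ) * C := by
  have hk := measurePreserving_zpow hT k
  have h1 : ∫ x, ‖f ((T ^ k) x)‖ ∂μ = ∫ x, ‖f x‖ ∂μ :=
    hk.integral_comp (Homeomorph.measurableEmbedding _) fun x => ‖f x‖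
  rw [← h1, ← integral_mul_const]
  refine norm_integral_le_of_norm_le ((hk.integrable_comp_of_integrable hf).norm.mul_const C) ?_
  filter_upwards [hb] with x hx
  rw [norm_mul]
  exact mul_le_mul_of_nonneg_left hx (norm_nonneg _)

theorem aestronglyMeasurable_prod_comp_zpow {ι : Type*} {T : X ≃ₜ X}
    (hT : MeasurePreserving T μ μ) (s : Finset ι) {f : ι → X → ℂ} (hf : ∀ j, MemLp (f j) ⊤ μ)
    (k : ι → ℤ) : AEStronglyMeasurable (fun x => ∏ j ∈ s, f j ((T ^ k j) x)) μ :=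
  Finset.aestronglyMeasurable_fun_prod s fun j _ =>
    (hf j).aestronglyMeasurable.comp_measurePreserving (measurePreserving_zpow hT (k j))

theorem exists_ae_norm_prod_comp_zpow_le {ι : Type*} {T : X ≃ₜ X}
    (hT : MeasurePreserving T μ μ) (s : Finset ι) {f : ι → X → ℂ} (hf : ∀ j, MemLp (f j) ⊤ μ) :
    ∃ C : ℝ, ∀ k : ι → ℤ, ∀ᵐ x ∂μ, ‖∏ j ∈ s, f j ((T ^ k j) x)‖ ≤ C := by
  choose C hC using fun j => exists_ae_norm_le_of_memLp_top (hf j)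
  refine ⟨∏ j ∈ s, C j, fun k => ?_⟩
  have h1 : ∀ j ∈ s, ∀ᵐ x ∂μ, ‖f j ((T ^ k j) x)‖ ≤ C j := fun j _ =>
    (measurePreserving_zpow hT (k j)).quasiMeasurePreserving.ae (hC j)
  filter_upwards [(ae_ball_iff s.countable_toSet).mpr h1] with x hx
  rw [norm_prod]
  exact Finset.prod_le_prod (fun _ _ => norm_nonneg _) hx

variable [IsProbabilityMeasure μ]

theorem ContinuousMap.integrable_of_compactSpace [CompactSpace X] (F : C(X, ℂ)) :
    Integrable F μ :=
  F.continuous.integrable_of_hasCompactSupport (HasCompactSupport.of_compactSpace _)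

theorem exists_span_phaseFun_integral_sub_le [CompactSpace X] [T2Space X] [μ.WeaklyRegular]
    (P : AddSubgroup C(X, UnitAddCircle)) (hsep : ∀ x y : X, x ≠ y → ∃ φ ∈ P, φ x ≠ φ y)
    {f : X → ℂ} (hf : Integrable f μ) {ε : ℝ} (hε : 0 < ε) :
    ∃ F ∈ Submodule.span ℂ (phaseFun '' (P : Set C(X, UnitAddCircle))),
      ∫ x, ‖f x - F x‖ ∂μ ≤ ε := by
  obtain ⟨G, hG, hGi⟩ := hf.exists_boundedContinuous_integral_sub_le (half_pos hε)
  have hmem : G.toContinuousMap ∈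
      (Submodule.span ℂ (phaseFun '' (P : Set C(X, UnitAddCircle)))).topologicalClosure := by
    rw [span_phaseFun_closure_eq_top P hsep]; trivial
  obtain ⟨F, hF, hGF⟩ := Metric.mem_closure_iff.mp hmem (ε / 2) (half_pos hε)
  refine ⟨F, hF, ?_⟩
  have hd : ∀ x, ‖G x - F x‖ ≤ ε / 2 := fun x => by
    rw [← dist_eq_norm]
    exact (ContinuousMap.dist_apply_le_dist x).trans hGF.le
  have hFi : Integrable F μ := F.integrable_of_compactSpace
  calc ∫ x, ‖f x - F x‖ ∂μ ≤ ∫ x, (‖f x - G x‖ + ε / 2) ∂μ := by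
        refine integral_mono (hf.sub hFi).norm ((hf.sub hGi).norm.add (integrable_const _))
          fun x => ?_
        exact (norm_sub_le_norm_sub_add_norm_sub _ (G x) _).trans (add_le_add le_rfl (hd x))
    _ = ∫ x, ‖f x - G x‖ ∂μ + ε / 2 := by
        rw [integral_add (f := fun x => ‖f x - G x‖) (hf.sub hGi).norm (integrable_const _)]
        simp
    _ ≤ ε := by linarith

/-- Approximation in `L¹` suffices: the other factor is bounded and `T` preserves `μ`, so the error
is uniform in `n`. -/
theorem cesaroNull_integral_of_polyPhases [CompactSpace X] [T2Space X] [μ.WeaklyRegular]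
    {T : X ≃ₜ X} (hT : MeasurePreserving T μ μ) (P : AddSubgroup C(X, UnitAddCircle))
    (hsep : ∀ x y : X, x ≠ y → ∃ φ ∈ P, φ x ≠ φ y) {k : ℕ → ℤ} {b : ℕ → X → ℂ} {C : ℝ}
    (hb : ∀ n, ∀ᵐ x ∂μ, ‖b n x‖ ≤ C) (hbm : ∀ n, AEStronglyMeasurable (b n) μ)
    (hphase : ∀ φ ∈ P, CesaroNull fun n => ∫ x, phase (φ ((T ^ k n) x)) * b n x ∂μ)
    {f : X → ℂ} (hf : Integrable f μ) :
    CesaroNull fun n => ∫ x, f ((T ^ k n) x) * b n x ∂μ := by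
  have hC : 0 ≤ C := by
    obtain ⟨x, hx⟩ := (hb 0).exists
    exact (norm_nonneg _).trans hx
  have hspan : ∀ F ∈ Submodule.span ℂ (phaseFun '' (P : Set C(X, UnitAddCircle))),
      CesaroNull fun n => ∫ x, F ((T ^ k n) x) * b n x ∂μ := by
    intro F hF
    induction hF using Submodule.span_induction with
    | mem F hF => obtain ⟨φ, hφ, rfl⟩ := hF; exact hphase φ hφ
    | zero => simpa using cesaroNull_zero
    | add F G _ _ hF hG =>
      refine (hF.add hG).congr fun N => ?_
      congr 1
      refine Finset.sum_congr rfl fun n _ => ?_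
      dsimp only
      rw [← integral_add
        (integrable_comp_zpow_mul hT _ (hb n) (hbm n) F.integrable_of_compactSpace)
        (integrable_comp_zpow_mul hT _ (hb n) (hbm n) G.integrable_of_compactSpace)]
      simp only [ContinuousMap.add_apply, add_mul]
    | smul a F _ hF =>
      refine (hF.const_mul a).congr fun N => ?_
      congr 1
      refine Finset.sum_congr rfl fun n _ => ?_
      dsimp only
      rw [← integral_const_mul]
      simp only [ContinuousMap.smul_apply, smul_eq_mul, mul_assoc]
  refine cesaroNull_of_approx fun ε hε => ?_
  obtain ⟨F, hF, hfF⟩ := exists_span_phaseFun_integral_sub_le P hsep hf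
    (show 0 < ε / (C + 1) by positivity)
  refine ⟨_, hspan F hF, Eventually.of_forall fun N => ?_⟩
  refine (Finset.sum_le_card_nsmul _ _ ε fun n _ => ?_).trans (by simp [mul_comm])
  have hFi : Integrable F μ := F.integrable_of_compactSpace
  rw [← integral_sub (integrable_comp_zpow_mul hT _ (hb n) (hbm n) hf)
    (integrable_comp_zpow_mul hT _ (hb n) (hbm n) hFi)]
  simp only [← sub_mul]
  calc _ ≤ (∫ x, ‖f x - F x‖ ∂μ) * C :=
        norm_integral_comp_zpow_mul_le hT (k n) (hb n) (hf.sub hFi)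
    _ ≤ ε / (C + 1) * (C + 1) := by gcongr; linarith
    _ = ε := by field_simp

theorem memLp_phaseFun [CompactSpace X] (φ : C(X, UnitAddCircle)) : MemLp (phaseFun φ) ⊤ μ :=
  memLp_top_of_bound (phaseFun φ).integrable_of_compactSpace.aestronglyMeasurable 1
    (ae_of_all _ fun _ => (norm_phase _).le)

/-- To show that correlation averages of arbitrary bounded functions vanish it suffices to consider
phase functions that separate points. -/
theorem cesaroNull_integral_prod_of_phases [CompactSpace X] [T2Space X] [μ.WeaklyRegular]
    {T : X ≃ₜ X} (hT : MeasurePreserving T μ μ) (P : AddSubgroup C(X, UnitAddCircle))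
    (hsep : ∀ x y : X, x ≠ y → ∃ φ ∈ P, φ x ≠ φ y) {ι : Type*} [Fintype ι] {k : ι → ℕ → ℤ}
    {c : ℕ → ℂ} (hc : ∀ n, ‖c n‖ ≤ 1)
    (base : ∀ φ : ι → C(X, UnitAddCircle), (∀ j, φ j ∈ P) →
      CesaroNull fun n => c n * ∫ x, ∏ j, phase (φ j ((T ^ k j n) x)) ∂μ)
    {f : ι → X → ℂ} (hf : ∀ j, MemLp (f j) ⊤ μ) :
    CesaroNull fun n => c n * ∫ x, ∏ j, f j ((T ^ k j n) x) ∂μ := by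
  classical
  -- Induction over the set `s` of slots not yet known to hold phase functions; all remaining
  -- factors form the bounded weight `b`.
  suffices key : ∀ (s : Finset ι) (f : ι → X → ℂ), (∀ j, MemLp (f j) ⊤ μ) →
      (∀ j ∉ s, ∃ φ ∈ P, f j = phaseFun φ) →
      CesaroNull fun n => c n * ∫ x, ∏ j, f j ((T ^ k j n) x) ∂μ from
    key Finset.univ f hf fun j hj => absurd (Finset.mem_univ j) hj
  intro s
  induction s using Finset.induction_on with
  | empty =>
    intro f _ hfP
    choose φ hφ hfφ using fun j => hfP j (Finset.notMem_empty j)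
    simp only [hfφ]
    exact base φ hφ
  | insert a s ha ih =>
    intro f hf hfP
    have split : ∀ F : X → ℂ, (fun n => c n * ∫ x, ∏ j, (Function.update f a F) j ((T ^ k j n) x) ∂μ)
        = fun n => ∫ x, F ((T ^ k a n) x) *
          (c n * ∏ j ∈ Finset.univ.erase a, f j ((T ^ k j n) x)) ∂μ := by
      intro F
      funext n
      rw [← integral_const_mul]
      congr 1
      funext x
      rw [← Finset.mul_prod_erase _ _ (Finset.mem_univ a), Function.update_self]
      rw [Finset.prod_congr rfl fun j hj => by
        rw [Function.update_of_ne (Finset.ne_of_mem_erase hj)]]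
      ring
    have h0 := split (f a)
    rw [Function.update_eq_self] at h0
    rw [h0]
    obtain ⟨C, hC⟩ := exists_ae_norm_prod_comp_zpow_le hT (Finset.univ.erase a) hf
    refine cesaroNull_integral_of_polyPhases hT P hsep (C := C) (fun n => ?_)
      (fun n => (aestronglyMeasurable_prod_comp_zpow hT _ hf fun j => k j n).const_mul (c n))
      (fun φ hφ => ?_) ((hf a).integrable le_top)
    · filter_upwards [hC fun j => k j n] with x hx
      rw [norm_mul]
      calc _ ≤ 1 * ‖∏ j ∈ Finset.univ.erase a, f j ((T ^ k j n) x)‖ := by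
            gcongr; exact hc n
        _ ≤ C := by rw [one_mul]; exact hx
    · have h1 := ih (Function.update f a (phaseFun φ)) (fun j => ?_) (fun j hj => ?_)
      · rw [split] at h1
        exact h1
      · rcases eq_or_ne j a with rfl | hj
        · rw [Function.update_self]; exact memLp_phaseFun φ
        · rw [Function.update_of_ne hj]; exact hf j
      · rcases eq_or_ne j a with rfl | hja
        · exact ⟨φ, hφ, by rw [Function.update_self]⟩
        · rw [Function.update_of_ne hja]
          exact hfP j (by simp [hja, hj])

end Slots

/-! ### Polynomials with zero constant term -/

theorem IsIntegralPoly.dropConst {p : ℚ[X]} (hp : IsIntegralPoly p) :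
    IsIntegralPoly (dropConst p) := by
  intro n
  obtain ⟨a, ha⟩ := hp n
  obtain ⟨b, hb⟩ := hp 0
  refine ⟨a - b, ?_⟩
  rw [Int.cast_zero] at hb
  simp [_root_.dropConst, ha, hb]

theorem eval_dropConst_zero (p : ℚ[X]) : (dropConst p).eval 0 = 0 := by simp [dropConst]

theorem intValue_eq_dropConst_add {p : ℚ[X]} (hp : IsIntegralPoly p) (n : ℤ) :
    intValue p n = intValue (dropConst p) n + intValue p 0 := by
  have h0 := intValue_spec hp 0
  rw [Int.cast_zero] at h0
  have : ((intValue p n : ℤ) : ℚ) = ((intValue (dropConst p) n + intValue p 0 : ℤ) : ℚ) := by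
    rw [Int.cast_add, intValue_spec hp, intValue_spec hp.dropConst, h0]
    simp [dropConst]
  exact_mod_cast this

theorem zero_mem_weylPolys {r : ℕ} (p : Fin r → ℚ[X]) (d : ℕ) : (0 : ℝ[X]) ∈ weylPolys p d := by
  cases d with
  | zero => rfl
  | succ k => exact ⟨0, by simp, by simp⟩

theorem cesaroNull_phase_intValue_mul {h : ℚ[X]} (hh : IsIntegralPoly h) (hne : dropConst h ≠ 0)
    {α : ℝ} (hα : Irrational α) {m : ℤ} (hm : m ≠ 0) :
    CesaroNull fun n => phase (m • (((intValue h n : ℝ) * α : ℝ) : UnitAddCircle)) := by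
  obtain ⟨k, hk⟩ : ∃ k, (dropConst h).coeff k ≠ 0 := by
    by_contra! hcon
    exact hne (Polynomial.ext fun k => by simpa using hcon k)
  have hk1 : 1 ≤ k := by
    rw [Nat.one_le_iff_ne_zero]
    rintro rfl
    exact hk (by rw [coeff_zero_eq_eval_zero, eval_dropConst_zero])
  have hhk : h.coeff k ≠ 0 := by
    rw [dropConst, coeff_sub, coeff_C_of_ne_zero (by omega), sub_zero] at hk
    exact hk
  have hirr : Irrational ((C ((m : ℝ) * α) * h.map (algebraMap ℚ ℝ)).coeff k) := by
    rw [coeff_C_mul, coeff_map, eq_ratCast]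
    exact (hα.intCast_mul hm).mul_ratCast hhk
  refine (cesaroNull_phase_of_irrational_coeff _ hk1 hirr).congr fun N => ?_
  congr 1
  refine Finset.sum_congr rfl fun n _ => ?_
  have h1 : (h.map (algebraMap ℚ ℝ)).eval (n : ℝ) = (intValue h n : ℝ) := by
    have h2 := intValue_spec hh n
    rw [Int.cast_natCast] at h2
    have h3 : (((h.eval (n : ℚ) : ℚ)) : ℝ) = (h.map (algebraMap ℚ ℝ)).eval (n : ℝ) := by
      rw [eval_map_algebraMap, ← eq_ratCast (algebraMap ℚ ℝ), ← aeval_algebraMap_apply_eq_algebraMap_eval]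
      simp
    rw [← h3, ← h2, Rat.cast_intCast]
  dsimp only
  rw [eval_mul, eval_C, h1, ← AddCircle.coe_zsmul]
  congr 2
  rw [zsmul_eq_mul]
  ring

/-! ### Averages of correlations -/

section Correlations

variable {X : Type*} [TopologicalSpace X]

/-- `T^c` commutes with `diffOp T`. This absorbs the constant terms `p_j(0)` into the phase
polynomials. -/
theorem comp_zpow_mem_polyPhases {T : X ≃ₜ X} {d : ℕ} {φ : C(X, UnitAddCircle)}
    (hφ : φ ∈ polyPhases T d) (c : ℤ) :
    φ.comp ((T ^ c : X ≃ₜ X) : C(X, X)) ∈ polyPhases T d := by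
  have h1 : ∀ (i : ℕ) (ψ : C(X, UnitAddCircle)),
      (diffOp T ^ i) (ψ.comp ((T ^ c : X ≃ₜ X) : C(X, X))) =
        ((diffOp T ^ i) ψ).comp ((T ^ c : X ≃ₜ X) : C(X, X)) := by
    intro i
    induction i with
    | zero => intro ψ; rfl
    | succ i ih =>
      intro ψ
      rw [diffOp_pow_succ_apply, diffOp_pow_succ_apply, ← ih]
      congr 1
      ext x
      have hcomm : (T ^ c) (T x) = T ((T ^ c) x) := by
        rw [← Homeomorph.mul_apply, ← Homeomorph.mul_apply, ← zpow_add_one, ← zpow_one_add,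
          add_comm]
      simp [diffOp_apply, hcomm]
  rw [mem_polyPhases, h1, mem_polyPhases.mp hφ]
  rfl

variable [MeasurableSpace X] [BorelSpace X] {μ : Measure X} [IsProbabilityMeasure μ]

/-- The pointwise averages vanish almost everywhere, and dominated convergence passes to the
integral. `h(0)` and `φ₀` only contribute factors independent of `n`, so `φ₀` may be arbitrary. -/
theorem cesaroNull_twisted_integral_phases {T : X ≃ₜ X} (hT : MeasurePreserving T μ μ) {r d : ℕ}
    (hd : 1 ≤ d) {p : Fin r → ℚ[X]} (hp : ∀ j, IsIntegralPoly (p j)) {h : ℚ[X]}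
    (hh : IsIntegralPoly h)
    (hWP : (dropConst h).map (algebraMap ℚ ℝ) ∉ weylPolys (fun j => dropConst (p j)) d) {α : ℝ}
    (hα : Irrational α) {m : ℤ} (hm : m ≠ 0) (φ₀ : C(X, UnitAddCircle))
    {φ : Fin r → C(X, UnitAddCircle)} (hφ : ∀ j, φ j ∈ polyPhases T d) :
    CesaroNull fun n => phase (m • (((intValue h n : ℝ) * α : ℝ) : UnitAddCircle)) *
      ∫ x, phase (φ₀ x) * ∏ j, phase (φ j ((T ^ intValue (p j) n) x)) ∂μ := by
  have key := ae_cesaroNull_of_notMem_weylPolys hT hd (fun j => (hp j).dropConst)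
    (fun j => eval_dropConst_zero (p j)) hh.dropConst (eval_dropConst_zero h) hWP hα hm
    fun j => comp_zpow_mem_polyPhases (hφ j) (intValue (p j) 0)
  set A : ℕ → X → ℂ := fun n x => phase (m • (((intValue h n : ℝ) * α : ℝ) : UnitAddCircle)) *
    (phase (φ₀ x) * ∏ j, phase (φ j ((T ^ intValue (p j) n) x))) with hA
  have hAn : ∀ n x, ‖A n x‖ = 1 := fun n x => by
    simp only [hA, norm_mul, norm_prod, norm_phase, Finset.prod_const_one, one_mul]
  have hAc : ∀ n, Continuous (A n) := fun n =>
    continuous_const.mul ((continuous_phase.comp φ₀.continuous).mul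
      (continuous_finsetProd _ fun j _ => continuous_phase.comp
        ((φ j).continuous.comp (Homeomorph.continuous _))))
  have hAi : ∀ n, Integrable (A n) μ := fun n =>
    Integrable.of_bound (hAc n).aestronglyMeasurable 1 (ae_of_all _ fun x => (hAn n x).le)
  have hae : ∀ᵐ x ∂μ, CesaroNull fun n => A n x := by
    filter_upwards [key] with x hx
    refine (hx.const_mul (phase (m • (((intValue h 0 : ℝ) * α : ℝ) : UnitAddCircle)) *
      phase (φ₀ x))).congr fun N => ?_
    congr 1
    refine Finset.sum_congr rfl fun n _ => ?_
    simp only [hA]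
    rw [intValue_eq_dropConst_add hh n, phase_add, phase_sum, Int.cast_add, add_mul,
      AddCircle.coe_add, smul_add, phase_add]
    have : ∀ j, phase (φ j ((T ^ intValue (p j) n) x)) =
        phase ((φ j).comp ((T ^ intValue (p j) 0 : X ≃ₜ X) : C(X, X))
          ((T ^ intValue (dropConst (p j)) n) x)) := fun j => by
      rw [intValue_eq_dropConst_add (hp j) n, add_comm, zpow_add]
      rfl
    simp only [this]
    ring
  have hlim := tendsto_integral_of_dominated_convergence (μ := μ)
    (F := fun (N : ℕ) x => (1 / (N : ℂ)) * ∑ n ∈ Finset.range N, A n x) (f := fun _ => 0)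
    (fun _ => (1 : ℝ)) (fun N => (continuous_const.mul
      (continuous_finsetSum _ fun n _ => hAc n)).aestronglyMeasurable)
    (integrable_const _) (fun N => ae_of_all _ fun x => ?_) hae
  · rw [integral_zero] at hlim
    refine hlim.congr fun N => ?_
    rw [integral_const_mul, integral_finsetSum _ fun n _ => hAi n]
    simp only [hA, integral_const_mul]
  · rw [norm_mul, norm_div, norm_one, Complex.norm_natCast]
    have h1 : ‖∑ n ∈ Finset.range N, A n x‖ ≤ N := by
      refine (norm_sum_le _ _).trans ?_
      simp [hAn]
    rcases Nat.eq_zero_or_pos N with rfl | hN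
    · simp
    · have : (0 : ℝ) < N := by exact_mod_cast hN
      rw [one_div, inv_mul_le_iff₀ this]
      simpa using h1

end Correlations

/-! ### Assembly of the theorem -/

theorem CesaroNull.tendsto_Icc {u : ℕ → ℂ} {C : ℝ} (hu : CesaroNull u) (hC : ∀ n, ‖u n‖ ≤ C) :
    Tendsto (fun N : ℕ => (1 / (N : ℂ)) * ∑ n ∈ Finset.Icc 1 N, u n) atTop (𝓝 0) := by
  refine (hu.shift hC 1).congr fun N => ?_
  congr 1
  rw [Finset.range_eq_Ico, Finset.sum_Ico_add' u 0 N 1]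
  rfl

theorem RiemannIntegrableCircle.exists_norm_le {g : UnitAddCircle → ℂ}
    (hg : RiemannIntegrableCircle g) : ∃ C : ℝ, 0 ≤ C ∧ ∀ θ, ‖g θ‖ ≤ C := by
  obtain ⟨c, w, hcw, -⟩ := hg.exists_continuous_sandwich one_pos
  refine ⟨‖c‖ + ‖w‖, by positivity, fun θ => ?_⟩
  calc ‖g θ‖ = ‖c θ + (g θ - c θ)‖ := by rw [add_sub_cancel]
    _ ≤ ‖c θ‖ + ‖g θ - c θ‖ := norm_add_le _ _
    _ ≤ ‖c‖ + ‖w‖ := add_le_add (c.norm_coe_le_norm θ)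
        ((hcw θ).trans ((le_abs_self _).trans (w.norm_coe_le_norm θ)))

theorem mainTheorem6 (d r : ℕ) (hd : 1 ≤ d) (hr : 1 ≤ r)
    {X : Type*} [AddCommGroup X] [TopologicalSpace X] [IsTopologicalAddGroup X]
    [MeasurableSpace X] [BorelSpace X] (μ : Measure X) (T : X ≃ₜ X)
    (hX : IsStepWeylSystem d μ T)
    (p : Fin r → ℚ[X]) (hp : ∀ j, IsIntegralPoly (p j)) (hdist : EssentiallyDistinct p)
    (h : ℚ[X]) (hh : IsIntegralPoly h)
    (hWP : (dropConst h).map (algebraMap ℚ ℝ) ∉ weylPolys (fun j => dropConst (p j)) d)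
    (α : ℝ) (hα : Irrational α)
    (g : UnitAddCircle → ℂ) (hg : RiemannIntegrableCircle g) (hg0 : ∫ t, g t = 0)
    (f₀ : X → ℂ) (hf₀ : MemLp f₀ ⊤ μ) (f : Fin r → X → ℂ) (hf : ∀ j, MemLp (f j) ⊤ μ) :
    Tendsto
      (fun N : ℕ => (1 / (N : ℂ)) * ∑ n ∈ Finset.Icc 1 N,
        g (((intValue h (n : ℤ) : ℝ) * α : ℝ) : UnitAddCircle) *
          ∫ x, f₀ x * ∏ j, f j ((T ^ intValue (p j) (n : ℤ)) x) ∂μ)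
      atTop (𝓝 0) := by
  obtain ⟨⟨hXtf, -, hprob, hTaff, herg⟩, hnil⟩ := hX
  have hT : MeasurePreserving T μ μ := herg.toMeasurePreserving
  have hsep : ∀ x y : X, x ≠ y → ∃ φ ∈ polyPhases T d, φ x ≠ φ y := fun x y hxy =>
    exists_mem_polyPhases_separating hXtf hTaff hd hnil hxy
  have htop : CompactSpace X ∧ T2Space X ∧ TopologicalSpace.PseudoMetrizableSpace X := by
    obtain ⟨k, F, _, _, _, _, ⟨ψ⟩⟩ := hXtf
    have : CompactSpace ((Fin k → UnitAddCircle) × F) := inferInstance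
    exact ⟨ψ.toHomeomorph.symm.compactSpace, ψ.toHomeomorph.symm.t2Space,
      ψ.toHomeomorph.isInducing.pseudoMetrizableSpace⟩
  obtain ⟨_, _, _⟩ := htop
  -- Zero is always a Weyl polynomial, so `h` is non-constant and `h(n)α` equidistributes.
  have hne : dropConst h ≠ 0 := by
    intro h0
    rw [h0, Polynomial.map_zero] at hWP
    exact hWP (zero_mem_weylPolys _ _)
  -- `f₀` becomes one more slot, with exponent `0`, so that it too can be replaced by a phase
  -- function.
  set k : Fin (r + 1) → ℕ → ℤ :=
    Fin.cons (fun _ => 0) fun j n => intValue (p j) (n : ℤ) with hk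
  set f' : Fin (r + 1) → X → ℂ := Fin.cons f₀ f with hf'
  have hf'm : ∀ j, MemLp (f' j) ⊤ μ := fun j => by
    refine Fin.cases ?_ (fun j => ?_) j
    · exact hf₀
    · exact hf j
  have hprod : ∀ (n : ℕ) (x : X), ∏ j, f' j ((T ^ k j n) x) =
      f₀ x * ∏ j, f j ((T ^ intValue (p j) (n : ℤ)) x) := fun n x => by
    rw [Fin.prod_univ_succ]
    simp [hk, hf']
  obtain ⟨C, hC⟩ := exists_ae_norm_prod_comp_zpow_le hT Finset.univ hf'm
  set J : ℕ → ℂ := fun n => ∫ x, f₀ x * ∏ j, f j ((T ^ intValue (p j) (n : ℤ)) x) ∂μ with hJ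
  have hJC : ∀ n, ‖J n‖ ≤ C := fun n => by
    have h1 : ∀ᵐ x ∂μ, ‖f₀ x * ∏ j, f j ((T ^ intValue (p j) (n : ℤ)) x)‖ ≤ C := by
      filter_upwards [hC fun j => k j n] with x hx
      rw [← hprod]
      exact hx
    simpa using norm_integral_le_of_norm_le_const h1
  have htw : ∀ m : ℤ, m ≠ 0 → CesaroNull fun n =>
      phase (m • (((intValue h (n : ℤ) : ℝ) * α : ℝ) : UnitAddCircle)) * J n := by
    intro m hm
    have h1 := cesaroNull_integral_prod_of_phases (μ := μ) hT (polyPhases T d) hsep (k := k)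
      (c := fun n => phase (m • (((intValue h (n : ℤ) : ℝ) * α : ℝ) : UnitAddCircle)))
      (fun n => (norm_phase _).le) (fun φ hφ => ?_) hf'm
    · simpa only [hprod] using h1
    · have h2 := cesaroNull_twisted_integral_phases hT hd hp hh hWP hα hm (φ 0)
        fun j => hφ j.succ
      simpa only [Fin.prod_univ_succ, hk, Fin.cons_zero, Fin.cons_succ, zpow_zero,
        Homeomorph.one_apply] using h2
  obtain ⟨D, hD0, hD⟩ := hg.exists_norm_le
  refine CesaroNull.tendsto_Icc (C := D * C) (cesaroNull_riemannIntegrable_mul hJC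
    (fun m hm => cesaroNull_phase_intValue_mul hh hne hα hm) htw hg hg0) fun n => ?_
  rw [norm_mul]
  exact mul_le_mul (hD _) (hJC n) (norm_nonneg _) hD0
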